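/- Let $n\ge 1$. For $x\in\mathbb R^n$ and $M\in \mathrm O_n$ let $[x,M]$ be the isometry $z\mapsto M(z+x)$ of $\mathbb R^n$, and let $\mathrm{Iso}_n$ be the group of all these isometries under composition, with the product topology of $\mathbb R^n\times \mathrm O_n$. Let $\Gamma$ be a crystal group in dimension $n$, that is, a discrete subgroup of $\mathrm{Iso}_n$ whose orbit space $\mathbb R^n/\Gamma$ is compact. Let $\Pi=\{M:[x,M]\in\Gamma\text{ for some }x\}$ be its point group, $\mathcal L=\{\ell\in\mathbb R^n:[\ell,\mathrm{id}]\in\Gamma\}$ its translation lattice and $\mathcal L^*=\{\nu\in\mathbb R^n:\nu\cdot\ell\in\mathbb Z\text{ for all }\ell\in\mathcal L\}$ the dual lattice. For each $L\in\Pi$ fix $x_L\in\mathbb R^n$ with $[x_L,L]\in\Gamma$. Fix $\omega_0\in\mathbb R^n$ such that $M(\omega_0+\nu)\neq\omega_0$ for all $(\nu,M)\in\mathcal L^*\times\Pi$ with $(\nu,M)\ne(0,\mathrm{id})$. Let $$\Omega=\{\omega\in\mathbb R^n:\|\omega-\omega_0\|<\|\omega-M(\omega_0+\nu)\|\text{ for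 all }(\nu,M)\in\mathcal L^*\times\Pi,\ (\nu,M)\neq(0,\mathrm{id})\}$$ and $\Pi\Omega=\bigcup_{L\in\Pi}L\Omega$ (a disjoint union), both equipped with Lebesgue measure. A measurable range function for $\ell^2(\mathcal L^*)$ based on a measurable space $X$ is a map $J$ from $X$ to the closed subspaces of $\ell^2(\mathcal L^*)$ such that $t\mapsto\langle P_{J(t)}\xi,\eta\rangle$ is measurable for all $\xi,\eta\in\ell^2(\mathcal L^*)$, where $P_{J(t)}$ is the orthogonal projection onto $J(t)$. If $X$ carries a measure, $\mathcal M_J$ is the set of $F\in L^2(X,\ell^2(\mathcal L^*))$ with $F(t)\in J(t)$ for a.e. $t\in X$. For $L\in\Pi$ let $U_L$ be the unitary operator $(U_Lh)(\nu)=e^{2\pi i\nu\cdot x_L}h(\nu)$ on $\ell^2(\mathcal L^*)$. For a range function $J$ based on $\Omega$, its twisted extension $J^\Gamma$ to $\Pi\Omega$ is $J^\Gamma(L\omega)=U_LJ(\omega)$ for $\omega\in\Omega$, $L\in\Pi$. Let $\{\delta_\nu\}_{\nu\in\mathcal L^*}$ be the standard basis of $\ell^2(\mathcal L^*)$, and let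 $f\mapsto\widehat f$ be the unitary Fourier transform on $L^2(\mathbb R^n)$ with $\widehat f(\omega)=\int f(x)e^{2\pi i\omega\cdot x}\,dx$ for $f\in L^1(\mathbb R^n)\cap L^2(\mathbb R^n)$. Let $\mathcal V$ be a closed subspace of $L^2(\mathbb R^n)$. Then $\mathcal V$ is $\Gamma$-shift invariant, meaning that $z\mapsto f(M^{-1}z-x)$ belongs to $\mathcal V$ for all $f\in\mathcal V$ and $[x,M]\in\Gamma$, if and only if there exists a measurable range function $J$ for $\ell^2(\mathcal L^*)$ based on $\Omega$ such that $\mathcal V$ is exactly the set of those $f\in L^2(\mathbb R^n)$ for which there exists $F\in\mathcal M_{J^\Gamma}$ with $$\widehat f\big(L(\omega+\nu)\big)=\langle F(L\omega),\delta_\nu\rangle\qquad\text{for a.e. }\omega\in\Omega,\text{ every }L\in\Pi\text{ and every }\nu\in\mathcal L^*.$$ -/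

import Mathlib

open MeasureTheory

namespace CrystalShift

noncomputable section

/-- Euclidean space `ℝⁿ`. -/
abbrev E (n : ℕ) : Type := EuclideanSpace ℝ (Fin n)

/-- The orthogonal group `O_n`, as the group of linear isometries of `ℝⁿ`. -/
abbrev O (n : ℕ) : Type := E n ≃ₗᵢ[ℝ] E n

/-- The group of all (affine) isometries of `ℝⁿ`; the product is composition. -/
abbrev EucIso (n : ℕ) : Type := E n ≃ᵃⁱ[ℝ] E n

/-- The isometry `[x, M] : z ↦ M (z + x)`. -/
def isom {n : ℕ} (x : E n) (M : O n) : EucIso n :=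
  (AffineIsometryEquiv.constVAdd ℝ (E n) x).trans M.toAffineIsometryEquiv

@[simp] theorem isom_apply {n : ℕ} (x : E n) (M : O n) (z : E n) : isom x M z = M (z + x) := by
  simp [isom, add_comm]

/-- The homomorphism `q [x, M] = M`. -/
def linPart (n : ℕ) : EucIso n →* O n where
  toFun g := g.linearIsometryEquiv
  map_one' := rfl
  map_mul' _ _ := rfl

@[simp] theorem linPart_isom {n : ℕ} (x : E n) (M : O n) : linPart n (isom x M) = M := by
  ext1 v
  have h := (isom x M).map_vsub v 0
  simp only [isom_apply, vsub_eq_sub, sub_zero, ← map_sub, add_sub_add_right_eq_sub] at h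
  exact h

/-- The vector `x` for which `g = [x, M]`. -/
def transPart {n : ℕ} (g : EucIso n) : E n := (linPart n g).symm (g 0)

theorem isom_transPart_linPart {n : ℕ} (g : EucIso n) : isom (transPart g) (linPart n g) = g := by
  ext1 z
  have h := g.map_vsub z 0
  simp only [vsub_eq_sub, sub_zero] at h
  rw [isom_apply, map_add, transPart, LinearIsometryEquiv.apply_symm_apply]
  change g.linearIsometryEquiv z + g 0 = g z
  rw [h, sub_add_cancel]

/-- The topology of the isometry group: the product topology of `ℝⁿ × O_n` in the coordinates
`[x, M]`, where `O_n` carries the topology of the (finite-dimensional) space of linear maps. -/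
instance instTopologicalSpaceEucIso (n : ℕ) : TopologicalSpace (EucIso n) :=
  TopologicalSpace.induced
    (fun g => ((transPart g, ((linPart n g).toContinuousLinearEquiv : E n →L[ℝ] E n)) :
      E n × (E n →L[ℝ] E n))) inferInstance

/-- Isometries act on `ℝⁿ` by evaluation. -/
instance instMulActionEucIso (n : ℕ) : MulAction (EucIso n) (E n) where
  smul g z := g z
  one_smul _ := rfl
  mul_smul _ _ _ := rfl

/-- A crystal group in dimension `n`: a discrete subgroup of the isometry group with compact
orbit space. -/
structure IsCrystalGroup {n : ℕ} (Γ : Subgroup (EucIso n)) : Prop where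
  discrete : DiscreteTopology Γ
  cocompact : CompactSpace (MulAction.orbitRel.Quotient Γ (E n))

/-- The point group `Π = q(Γ)`. -/
def pointGroup {n : ℕ} (Γ : Subgroup (EucIso n)) : Subgroup (O n) := Γ.map (linPart n)

/-- The translation lattice `𝓛 = {ℓ : [ℓ, id] ∈ Γ}`. -/
def lattice {n : ℕ} (Γ : Subgroup (EucIso n)) : AddSubgroup (E n) where
  carrier := {l | isom l 1 ∈ Γ}
  zero_mem' := by
    have : isom (0 : E n) 1 = 1 := by ext1 z; simp
    simp only [Set.mem_ofPred_eq, this, one_mem]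
  add_mem' {a b} ha hb := by
    have : isom (a + b) 1 = isom a 1 * isom b 1 := by
      ext1 z
      simp only [isom_apply, AffineIsometryEquiv.coe_mul, Function.comp_apply,
        LinearIsometryEquiv.coe_one, id_eq]
      abel
    simp only [Set.mem_ofPred_eq] at ha hb ⊢
    rw [this]
    exact mul_mem ha hb
  neg_mem' {a} ha := by
    have : isom (-a) 1 = (isom a 1)⁻¹ := by
      rw [eq_inv_iff_mul_eq_one]
      ext1 z
      simp
    simp only [Set.mem_ofPred_eq] at ha ⊢
    rw [this]
    exact inv_mem ha

/-- The dual lattice `𝓛* = {ν : ν · ℓ ∈ ℤ for all ℓ ∈ 𝓛}`. -/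
def dualLattice {n : ℕ} (Γ : Subgroup (EucIso n)) : AddSubgroup (E n) where
  carrier := {ν | ∀ l ∈ lattice Γ, ∃ k : ℤ, inner ℝ ν l = (k : ℝ)}
  zero_mem' l _ := ⟨0, by simp⟩
  add_mem' {a b} ha hb l hl := by
    obtain ⟨j, hj⟩ := ha l hl
    obtain ⟨k, hk⟩ := hb l hl
    exact ⟨j + k, by rw [inner_add_left, hj, hk]; push_cast; rfl⟩
  neg_mem' {a} ha l hl := by
    obtain ⟨j, hj⟩ := ha l hl
    exact ⟨-j, by rw [inner_neg_left, hj]; push_cast; rfl⟩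

/-- `ω₀` has trivial stabilizer in `Γ* = 𝓛* ⋊ Π`, which acts on `ℝⁿ` by
`(ν, M) · ω = M (ω + ν)`. -/
def HasTrivialStabilizer {n : ℕ} (Γ : Subgroup (EucIso n)) (ω₀ : E n) : Prop :=
  ∀ (ν : dualLattice Γ) (M : pointGroup Γ), (M : O n) (ω₀ + ν) = ω₀ → (ν, M) = (0, 1)

/-- The Dirichlet domain `Ω` of `Γ* = 𝓛* ⋊ Π` containing `ω₀`. -/
def dirichletDomain {n : ℕ} (Γ : Subgroup (EucIso n)) (ω₀ : E n) : Set (E n) :=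
  {ω | ∀ (ν : dualLattice Γ) (M : pointGroup Γ), (ν, M) ≠ (0, 1) →
    ‖ω - ω₀‖ < ‖ω - (M : O n) (ω₀ + ν)‖}

/-- `ΠΩ`, the union of the sets `L Ω` over `L ∈ Π`. -/
def pointOrbit {n : ℕ} (Γ : Subgroup (EucIso n)) (ω₀ : E n) : Set (E n) :=
  {θ | ∃ (L : pointGroup Γ) (ω : dirichletDomain Γ ω₀), (L : O n) ω = θ}

/-- The point `Lω` of `ΠΩ`. -/
def rot {n : ℕ} {Γ : Subgroup (EucIso n)} {ω₀ : E n} (L : pointGroup Γ)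
    (ω : dirichletDomain Γ ω₀) : pointOrbit Γ ω₀ :=
  ⟨(L : O n) ω, L, ω, rfl⟩

/-- The sets `L Ω`, `L ∈ Π`, are pairwise disjoint. -/
theorem rot_inj {n : ℕ} {Γ : Subgroup (EucIso n)} {ω₀ : E n} {L M : pointGroup Γ}
    {ω ω' : dirichletDomain Γ ω₀} (h : rot L ω = rot M ω') : L = M ∧ ω = ω' := by
  have h0 : (L : O n) ω = (M : O n) ω' := congrArg Subtype.val h
  have key : ∀ (A B : pointGroup Γ) (a b : dirichletDomain Γ ω₀), (A : O n) a = (B : O n) b →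
      A ≠ B → ‖(b : E n) - ω₀‖ < ‖(a : E n) - ω₀‖ := by
    intro A B a b hab hne
    have hne' : ((0 : dualLattice Γ), B⁻¹ * A) ≠ (0, 1) := fun hh =>
      hne (inv_mul_eq_one.mp (Prod.ext_iff.mp hh).2).symm
    have h1 := b.2 0 (B⁻¹ * A) hne'
    have h2 : (b : E n) = ((B⁻¹ * A : pointGroup Γ) : O n) a := by
      have : (b : E n) = (B : O n).symm ((A : O n) a) := by
        rw [hab, LinearIsometryEquiv.symm_apply_apply]
      exact this
    calc ‖(b : E n) - ω₀‖ < ‖(b : E n) - ((B⁻¹ * A : pointGroup Γ) : O n) (ω₀ + (0 : dualLattice Γ))‖ := h1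
      _ = ‖((B⁻¹ * A : pointGroup Γ) : O n) a - ((B⁻¹ * A : pointGroup Γ) : O n) ω₀‖ := by
        rw [← h2]; simp
      _ = ‖(a : E n) - ω₀‖ := by rw [← map_sub, LinearIsometryEquiv.norm_map]
  have hLM : L = M := by
    by_contra hne
    exact lt_asymm (key L M ω ω' h0 hne) (key M L ω' ω h0.symm (Ne.symm hne))
  subst hLM
  exact ⟨rfl, Subtype.ext ((L : O n).injective h0)⟩

/-- The Hilbert space `L²(ℝⁿ)`. -/
abbrev L2 (n : ℕ) : Type := Lp ℂ 2 (volume : Measure (E n))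

/-- The Hilbert space `ℓ²(𝓛*)`. -/
abbrev ell2 {n : ℕ} (Γ : Subgroup (EucIso n)) : Type := lp (fun _ : dualLattice Γ => ℂ) 2

open Classical in
/-- The basis vector `δ_ν` of `ℓ²(𝓛*)`. -/
def delta {n : ℕ} {Γ : Subgroup (EucIso n)} (ν : dualLattice Γ) : ell2 Γ := lp.single 2 ν (1 : ℂ)

/-- The unimodular number `e^{2πi ν·y}`. -/
def phase {n : ℕ} {Γ : Subgroup (EucIso n)} (y : E n) (ν : dualLattice Γ) : ℂ :=
  Complex.exp (2 * Real.pi * Complex.I * ((inner ℝ (ν : E n) y : ℝ) : ℂ))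

theorem norm_phase {n : ℕ} {Γ : Subgroup (EucIso n)} (y : E n) (ν : dualLattice Γ) :
    ‖phase y ν‖ = 1 := by
  rw [phase, show (2 * Real.pi * Complex.I * ((inner ℝ (ν : E n) y : ℝ) : ℂ))
    = ((2 * Real.pi * inner ℝ (ν : E n) y : ℝ) : ℂ) * Complex.I by push_cast; ring]
  exact Complex.norm_exp_ofReal_mul_I _

theorem phase_neg_mul {n : ℕ} {Γ : Subgroup (EucIso n)} (y : E n) (ν : dualLattice Γ) :
    phase (-y) ν * phase y ν = 1 := by
  rw [phase, phase, ← Complex.exp_add, inner_neg_right]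
  simp

/-- Multiplication by `e^{2πi ν·y}` as a linear map on `ℓ²(𝓛*)`. -/
def phaseMul {n : ℕ} (Γ : Subgroup (EucIso n)) (y : E n) : ell2 Γ →ₗ[ℂ] ell2 Γ where
  toFun h := ⟨fun ν => phase y ν * h ν, by
    refine (lp.memℓp h).mono' (fun ν => ?_)
    rw [norm_mul, norm_phase, one_mul]⟩
  map_add' f g := by
    ext ν
    exact mul_add _ _ _
  map_smul' c f := by
    ext ν
    exact mul_left_comm _ _ _

/-- The unitary operator of multiplication by `e^{2πi ν·y}` on `ℓ²(𝓛*)`; with `y = x_L` this is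
`U_L`. -/
def unitaryU {n : ℕ} (Γ : Subgroup (EucIso n)) (y : E n) : ell2 Γ ≃ₗᵢ[ℂ] ell2 Γ where
  toLinearEquiv := LinearEquiv.ofLinearMap (phaseMul Γ y) (phaseMul Γ (-y))
    (by
      ext h ν
      change phase y ν * (phase (-y) ν * h ν) = h ν
      rw [← mul_assoc, mul_comm (phase y ν), phase_neg_mul, one_mul])
    (by
      ext h ν
      change phase (-y) ν * (phase y ν * h ν) = h ν
      rw [← mul_assoc, phase_neg_mul, one_mul])
  norm_map' h := by
    change ‖phaseMul Γ y h‖ = ‖h‖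
    rw [lp.norm_eq_tsum_rpow (by norm_num), lp.norm_eq_tsum_rpow (by norm_num)]
    congr 1
    refine tsum_congr fun ν => ?_
    change ‖phase y ν * h ν‖ ^ _ = _
    rw [norm_mul, norm_phase, one_mul]

@[simp] theorem unitaryU_apply {n : ℕ} (Γ : Subgroup (EucIso n)) (y : E n) (h : ell2 Γ)
    (ν : dualLattice Γ) : unitaryU Γ y h ν = phase y ν * h ν := rfl

/-- A measurable range function for the Hilbert space `H` based on `X`: a map `J` from `X` to the
closed subspaces of `H` such that `t ↦ ⟨P_{J(t)} ξ, η⟩` is measurable for all `ξ, η`. (Mathlib's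
inner product is linear in the second argument.) -/
def IsMeasurableRangeFunction {X H : Type*} [MeasurableSpace X] [NormedAddCommGroup H]
    [InnerProductSpace ℂ H] [CompleteSpace H] (J : X → ClosedSubmodule ℂ H) : Prop :=
  ∀ ξ η : H, Measurable fun t => inner ℂ η ((J t).toSubmodule.starProjection ξ)

/-- `𝓜_J`: the functions `F ∈ L²(X, μ, H)` with `F(t) ∈ J(t)` for almost every `t`.
(For separable `H`, weakly measurable maps are strongly measurable, so Mathlib's `L²` of `H`-valued
maps is the `L²` defined through weak measurability.) -/
def rangeSpace {X H : Type*} [MeasurableSpace X] [NormedAddCommGroup H]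
    [InnerProductSpace ℂ H] (μ : Measure X) (J : X → ClosedSubmodule ℂ H) : Set (Lp H 2 μ) :=
  {F | ∀ᵐ t ∂μ, F t ∈ J t}

/-- The element `L ∈ Π` with `θ = Lω`, `ω ∈ Ω`, for `θ ∈ ΠΩ`. -/
def rotPart {n : ℕ} {Γ : Subgroup (EucIso n)} {ω₀ : E n} (θ : pointOrbit Γ ω₀) : pointGroup Γ :=
  Exists.choose θ.2

/-- The element `ω ∈ Ω` with `θ = Lω`, `L ∈ Π`, for `θ ∈ ΠΩ`. -/
def basePart {n : ℕ} {Γ : Subgroup (EucIso n)} {ω₀ : E n} (θ : pointOrbit Γ ω₀) :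
    dirichletDomain Γ ω₀ :=
  Exists.choose (Exists.choose_spec θ.2)

theorem rot_rotPart_basePart {n : ℕ} {Γ : Subgroup (EucIso n)} {ω₀ : E n}
    (θ : pointOrbit Γ ω₀) : rot (rotPart θ) (basePart θ) = θ :=
  Subtype.ext (Exists.choose_spec (Exists.choose_spec θ.2))

/-- The twisted extension `J^Γ` to `ΠΩ` of a map `J` on `Ω`: the value at `θ = Lω` is
`U_L J(ω)`. The pair `(L, ω)` is determined by `θ`; see `twistedExtension_rot`. -/
def twistedExtension {n : ℕ} {Γ : Subgroup (EucIso n)} {ω₀ : E n} (x : pointGroup Γ → E n)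
    (J : dirichletDomain Γ ω₀ → ClosedSubmodule ℂ (ell2 Γ)) (θ : pointOrbit Γ ω₀) :
    ClosedSubmodule ℂ (ell2 Γ) :=
  (J (basePart θ)).mapEquiv (unitaryU Γ (x (rotPart θ))).toContinuousLinearEquiv

theorem twistedExtension_rot {n : ℕ} {Γ : Subgroup (EucIso n)} {ω₀ : E n}
    (x : pointGroup Γ → E n) (J : dirichletDomain Γ ω₀ → ClosedSubmodule ℂ (ell2 Γ))
    (L : pointGroup Γ) (ω : dirichletDomain Γ ω₀) :
    twistedExtension x J (rot L ω) =
      (J ω).mapEquiv (unitaryU Γ (x L)).toContinuousLinearEquiv := by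
  obtain ⟨h1, h2⟩ := rot_inj (rot_rotPart_basePart (rot L ω))
  rw [twistedExtension, h1, h2]

/-- Lebesgue measure on the subset `s` of `ℝⁿ`, as a measure on the subtype `s`. -/
def lebesgueOn {n : ℕ} (s : Set (E n)) : Measure s :=
  (volume : Measure (E n)).comap Subtype.val

theorem measurePreserving_eucIso {n : ℕ} (g : EucIso n) :
    MeasurePreserving g (volume : Measure (E n)) volume := by
  have h : (g : E n → E n) = fun z => linPart n g (z + transPart g) := by
    funext z
    rw [← isom_apply, isom_transPart_linPart]
  rw [h]
  exact (linPart n g).measurePreserving.comp (measurePreserving_add_right volume (transPart g))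

/-- The natural representation: `π(g) f = f ∘ g⁻¹`, so that
`π[x, M] f (z) = f (M⁻¹ z - x)`. -/
def shift {n : ℕ} (g : EucIso n) (f : L2 n) : L2 n :=
  Lp.compMeasurePreserving (g⁻¹ : EucIso n) (measurePreserving_eucIso g⁻¹) f

/-- `V` is invariant under shifts by elements of `Γ`. -/
def IsShiftInvariant {n : ℕ} (Γ : Subgroup (EucIso n)) (V : ClosedSubmodule ℂ (L2 n)) : Prop :=
  ∀ g ∈ Γ, ∀ f ∈ V, shift g f ∈ V

/-- The Fourier transform on `L²(ℝⁿ)` with the sign convention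
`f̂(ω) = ∫ f(x) e^{2πi ω·x} dx`. Mathlib's `𝓕` has the kernel `e^{-2πi ω·x}`, so this is
Mathlib's unitary map `𝓕⁻`. -/
def hat {n : ℕ} (f : L2 n) : L2 n := FourierTransformInv.fourierInv f

end

end CrystalShift

open CrystalShift

/-! The images of `Ω` under `𝓛* ⋊ Π` tile `ℝⁿ` up to null sets, so cutting `f̂` along the tiles
gives an isometry `fourierFiber` from `L²(ℝⁿ)` into `L²(ΠΩ, ℓ²(𝓛*))`. Under it a lattice translation
becomes multiplication by a scalar character, and `[x_L, L]` carries the fibre over `ω` to the fibre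
over `Lω`, applying `U_L` and a unimodular scalar (`ae_fourierFiber_shift`).

A space cut out by a twisted range function is therefore invariant: a product in `Γ` differs from
the chosen representative of its linear part by a lattice vector, on which the phase operators are
trivial (`fibers_mem_shift`).

Conversely, take a sequence with dense range in `V` and let `J(ω)` be the closed span of its fibres
over `ω`. Invariance and a.e. convergent subsequences put the fibres of every `f ∈ V` into the
twisted extension (`fibers_mem_rangeFunction`). For the reverse inclusion let `g ⊥ V`. Then `g` is
orthogonal to all lattice translates of `f ∈ V`, so all Fourier coefficients of the fibrewise inner
product vanish and the fibres are orthogonal almost everywhere (`ae_inner_fourierFiber_eq_zero`). A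
function with fibres in the twisted extension is thus orthogonal to `Vᗮ`, hence lies in `V`
(`mem_of_fibers_mem_rangeFunction`). -/

namespace CrystalShift

/-! ### The lattice, its dual and the point group. -/

section

variable {n : ℕ} {Γ : Subgroup (EucIso n)} {ω₀ : E n}

@[simp] theorem transPart_isom (x : E n) (M : O n) : transPart (isom x M) = x := by
  simp [transPart]

theorem isom_mul_isom (x y : E n) (M N : O n) :
    isom x M * isom y N = isom (y + N.symm x) (M * N) := by
  ext1 z
  simp [AffineIsometryEquiv.coe_mul, add_assoc]

theorem isom_inv (x : E n) (M : O n) : (isom x M)⁻¹ = isom (-(M x)) M⁻¹ := by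
  rw [inv_eq_iff_mul_eq_one, isom_mul_isom, mul_inv_cancel]
  ext1 z
  simp [LinearIsometryEquiv.inv_def]

theorem mem_lattice {l : E n} : l ∈ lattice Γ ↔ isom l 1 ∈ Γ := Iff.rfl

theorem exists_isom_mem_of_mem_pointGroup {M : O n} (hM : M ∈ pointGroup Γ) :
    ∃ x, isom x M ∈ Γ := by
  obtain ⟨g, hg, rfl⟩ := hM
  exact ⟨transPart g, by rwa [isom_transPart_linPart]⟩

theorem linPart_mem_pointGroup {g : EucIso n} (hg : g ∈ Γ) : linPart n g ∈ pointGroup Γ :=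
  ⟨g, hg, rfl⟩

theorem sub_mem_lattice {x y : E n} {M : O n} (hx : isom x M ∈ Γ) (hy : isom y M ∈ Γ) :
    x - y ∈ lattice Γ := by
  rw [mem_lattice]
  have : (isom y M)⁻¹ * isom x M = isom (x - y) 1 := by
    rw [isom_inv, isom_mul_isom, inv_mul_cancel]
    congr 1
    simp [LinearIsometryEquiv.symm_apply_apply, sub_eq_add_neg]
  rw [← this]
  exact mul_mem (inv_mem hy) hx

theorem map_mem_lattice {M : O n} (hM : M ∈ pointGroup Γ) {l : E n} (hl : l ∈ lattice Γ) :
    M l ∈ lattice Γ := by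
  obtain ⟨x, hx⟩ := exists_isom_mem_of_mem_pointGroup hM
  have : isom (M l) 1 = isom x M * isom l 1 * (isom x M)⁻¹ := by
    rw [eq_mul_inv_iff_mul_eq]
    ext1 z
    simp [add_right_comm, add_assoc, add_comm (M l)]
  rw [mem_lattice, this]
  exact mul_mem (mul_mem hx hl) (inv_mem hx)

theorem inner_map_left (M : O n) (x y : E n) : inner ℝ (M x) y = inner ℝ x (M.symm y) := by
  rw [← M.inner_map_map x (M.symm y), M.apply_symm_apply]

theorem map_mem_dualLattice {M : O n} (hM : M ∈ pointGroup Γ) {ν : E n} (hν : ν ∈ dualLattice Γ) :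
    M ν ∈ dualLattice Γ := fun l hl => by
  rw [inner_map_left]
  exact hν _ (map_mem_lattice (inv_mem hM) hl)

theorem discreteTopology_lattice [DiscreteTopology Γ] : DiscreteTopology (lattice Γ) := by
  refine DiscreteTopology.of_continuous_injective
    (f := fun l : lattice Γ => (⟨isom l 1, l.2⟩ : Γ)) ?_ ?_
  · refine Continuous.subtype_mk (continuous_induced_rng.mpr ?_) _
    change Continuous fun l : lattice Γ => (transPart (isom (l : E n) 1),
      ((linPart n (isom (l : E n) 1)).toContinuousLinearEquiv : E n →L[ℝ] E n))
    simp only [transPart_isom, linPart_isom]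
    fun_prop
  · intro a b hab
    have := congrArg (fun g : Γ => (g : EucIso n) 0) hab
    simpa using this

theorem isDiscrete_lattice [DiscreteTopology Γ] : IsDiscrete (lattice Γ : Set (E n)) :=
  ⟨discreteTopology_lattice⟩

theorem isClosed_lattice [DiscreteTopology Γ] : IsClosed (lattice Γ : Set (E n)) :=
  have := discreteTopology_lattice (Γ := Γ)
  AddSubgroup.isClosed_of_discrete

/-- If `M` fixes `𝓛` pointwise, then `M⁻¹ω₀ - ω₀` pairs to zero with `𝓛`, so it is a dual vector,
and `M` sends `ω₀` plus this vector to `ω₀`. -/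
theorem eq_one_of_fixes_lattice (hω₀ : HasTrivialStabilizer Γ ω₀) {M : O n}
    (hM : M ∈ pointGroup Γ) (h : ∀ l ∈ lattice Γ, M l = l) : M = 1 := by
  have hν : M.symm ω₀ - ω₀ ∈ dualLattice Γ := fun l hl => ⟨0, by
    have : inner ℝ (M.symm ω₀) l = inner ℝ ω₀ (M l) := by
      rw [inner_map_left]; rfl
    rw [inner_sub_left, this, h l hl, sub_self, Int.cast_zero]⟩
  have := hω₀ ⟨_, hν⟩ ⟨M, hM⟩ (by simp)
  exact congrArg Subtype.val (Prod.ext_iff.mp this).2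

theorem exists_finset_closure_lattice [DiscreteTopology Γ] :
    ∃ s : Finset (E n), AddSubgroup.closure (s : Set (E n)) = lattice Γ := by
  have : DiscreteTopology (AddSubgroup.toIntSubmodule (lattice Γ)) :=
    discreteTopology_lattice (Γ := Γ)
  have := instModuleFinite_of_discrete_submodule (AddSubgroup.toIntSubmodule (lattice Γ))
  obtain ⟨s, hs⟩ := Module.Finite.iff_fg.mp this
  refine ⟨s, ?_⟩
  rw [← Submodule.span_int_eq_addSubgroupClosure, hs]
  simp

/-- `Π` permutes `𝓛` and preserves norms, so each of finitely many generators has finitely many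
possible images; by `eq_one_of_fixes_lattice` these images determine the element. -/
theorem finite_pointGroup [DiscreteTopology Γ] (hω₀ : HasTrivialStabilizer Γ ω₀) :
    Finite (pointGroup Γ) := by
  obtain ⟨s, hs⟩ := exists_finset_closure_lattice (Γ := Γ)
  have hmem : ∀ l ∈ s, l ∈ lattice Γ := fun l hl => hs ▸ AddSubgroup.subset_closure hl
  have hfin : ∀ l : s, Finite ↥(Metric.closedBall (0 : E n) ‖(l : E n)‖ ∩ lattice Γ) := fun l =>
    (Metric.finite_isBounded_inter_isClosed isDiscrete_lattice Metric.isBounded_closedBall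
      isClosed_lattice).to_subtype
  refine Finite.of_injective (β := ∀ l : s, ↥(Metric.closedBall (0 : E n) ‖(l : E n)‖ ∩ lattice Γ))
    (fun M l => ⟨(M : O n) l, by simp, map_mem_lattice M.2 (hmem l l.2)⟩) fun M N hMN => ?_
  have key : (N⁻¹ * M : pointGroup Γ) = 1 := by
    refine Subtype.ext (eq_one_of_fixes_lattice hω₀ (N⁻¹ * M).2 fun l hl => ?_)
    rw [← hs] at hl
    induction hl using AddSubgroup.closure_induction with
    | mem l hl =>
      have : (M : O n) l = (N : O n) l := congrArg Subtype.val (congrFun hMN ⟨l, hl⟩)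
      change (N : O n).symm ((M : O n) l) = l
      rw [this, LinearIsometryEquiv.symm_apply_apply]
    | zero => simp
    | add a b _ _ ha hb => rw [map_add, ha, hb]
    | neg a _ ha => rw [map_neg, ha]
  exact (inv_mul_eq_one.mp key).symm

/-- A continuous `Γ`-invariant function is bounded, by cocompactness. The function `f` below would
be unbounded along any nonzero vector orthogonal to the lattice. -/
theorem span_lattice_eq_top (hΓ : IsCrystalGroup Γ) [Finite (pointGroup Γ)] :
    Submodule.span ℝ (lattice Γ : Set (E n)) = ⊤ := by
  have := Fintype.ofFinite (pointGroup Γ)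
  set W := Submodule.span ℝ (lattice Γ : Set (E n)) with hW
  choose x hx using fun L : pointGroup Γ => exists_isom_mem_of_mem_pointGroup L.2
  let f : E n → ℝ := fun z => ∑ L : pointGroup Γ, ‖Wᗮ.starProjection (isom (x L) L z)‖
  -- Two elements of `Γ` with the same linear part differ by a lattice vector, which the projection
  -- to `Wᗮ` kills.
  have hterm : ∀ g ∈ Γ, ∀ z, ∀ L : pointGroup Γ, linPart n g = L →
      Wᗮ.starProjection (g z) = Wᗮ.starProjection (isom (x L) L z) := by
    intro g hg z L hL
    rw [← isom_transPart_linPart g, hL] at hg ⊢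
    have h1 := sub_mem_lattice hg (hx L)
    have h2 : (L : O n) (transPart g - x L) ∈ W :=
      Submodule.subset_span (map_mem_lattice L.2 h1)
    rw [← sub_eq_zero, ← map_sub]
    simp only [isom_apply, ← map_sub, add_sub_add_left_eq_sub]
    rw [Submodule.starProjection_apply_eq_zero_iff]
    exact Submodule.le_orthogonal_orthogonal _ h2
  have hinv : ∀ g ∈ Γ, ∀ z, f (g z) = f z := by
    intro g hg z
    -- The summand at `L` for `g z` is the summand at `L * linPart n g` for `z`, so `g` only
    -- permutes the summands.
    refine Fintype.sum_equiv (Equiv.mulRight ⟨linPart n g, linPart_mem_pointGroup hg⟩) _ _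
      fun L => ?_
    have := hterm (isom (x L) L * g) (mul_mem (hx L) hg) z
      (L * ⟨linPart n g, linPart_mem_pointGroup hg⟩) (by simp)
    exact congrArg norm this
  have hcont : Continuous f := by
    refine continuous_finsetSum _ fun L _ => ?_
    exact (Wᗮ.starProjection.continuous.comp (isom (x L) (L : O n)).continuous).norm
  have hb : BddAbove (Set.range f) := by
    have := hΓ.cocompact
    let F : MulAction.orbitRel.Quotient Γ (E n) → ℝ := Quotient.lift f fun a b hab => by
      obtain ⟨g, hg⟩ := MulAction.orbitRel_apply.mp hab
      rw [← hg]
      exact hinv g g.2 b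
    have hF : Continuous F := hcont.quotient_lift _
    refine (isCompact_range hF).bddAbove.mono ?_
    rintro _ ⟨z, rfl⟩
    exact ⟨Quotient.mk _ z, rfl⟩
  rw [← Submodule.orthogonal_eq_bot_iff, Submodule.eq_bot_iff]
  intro u hu
  by_contra hu0
  obtain ⟨C, hC⟩ := hb
  have hle : ∀ t : ℝ, ‖Wᗮ.starProjection (t • u)‖ ≤ C := fun t => by
    rw [show Wᗮ.starProjection (t • u) = Wᗮ.starProjection ((1 : EucIso n) (t • u)) from rfl,
      hterm 1 (one_mem Γ) _ 1 rfl]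
    refine le_trans ?_ (hC ⟨t • u, rfl⟩)
    exact Finset.single_le_sum
      (f := fun L : pointGroup Γ => ‖Wᗮ.starProjection (isom (x L) L (t • u))‖)
      (fun _ _ => norm_nonneg _) (Finset.mem_univ 1)
  have hpos : 0 < ‖u‖ := norm_pos_iff.mpr hu0
  have := hle ((|C| + 1) / ‖u‖)
  rw [Submodule.starProjection_eq_self_iff.mpr (Submodule.smul_mem _ _ hu), norm_smul, norm_div,
    norm_norm, div_mul_cancel₀ _ hpos.ne', Real.norm_eq_abs, abs_of_pos (by positivity)] at this
  linarith [le_abs_self C]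

theorem injective_inner_lattice {s : Finset (E n)}
    (hs : AddSubgroup.closure (s : Set (E n)) = lattice Γ)
    (hspan : Submodule.span ℝ (lattice Γ : Set (E n)) = ⊤) {a b : E n}
    (h : ∀ l ∈ s, inner ℝ a l = inner ℝ b l) : a = b := by
  have h2 : ∀ v : E n, inner ℝ a v = inner ℝ b v := by
    intro v
    have hv : v ∈ Submodule.span ℝ (lattice Γ : Set (E n)) := hspan ▸ Submodule.mem_top
    induction hv using Submodule.span_induction with
    | mem l hl =>
      rw [SetLike.mem_coe, ← hs] at hl
      induction hl using AddSubgroup.closure_induction with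
      | mem l hl => exact h l hl
      | zero => simp
      | add a b _ _ ha hb => rw [inner_add_right, inner_add_right, ha, hb]
      | neg a _ ha => rw [inner_neg_right, inner_neg_right, ha]
    | zero => simp
    | add a b _ _ ha hb => rw [inner_add_right, inner_add_right, ha, hb]
    | smul c a _ ha => rw [inner_smul_right, inner_smul_right, ha]
  exact ext_inner_right ℝ h2

theorem countable_dualLattice [DiscreteTopology Γ]
    (hspan : Submodule.span ℝ (lattice Γ : Set (E n)) = ⊤) : Countable (dualLattice Γ) := by
  obtain ⟨s, hs⟩ := exists_finset_closure_lattice (Γ := Γ)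
  choose k hk using fun (ν : dualLattice Γ) (l : s) =>
    ν.2 l (hs ▸ AddSubgroup.subset_closure l.2)
  refine Function.Injective.countable (f := k) fun a b hab => Subtype.ext ?_
  refine injective_inner_lattice hs hspan fun l hl => ?_
  rw [hk a ⟨l, hl⟩, hk b ⟨l, hl⟩, hab]

/-- A dual vector is encoded by its integer pairings with generators of `𝓛`, and Cauchy–Schwarz
bounds these integers. -/
theorem finite_dualLattice_inter_closedBall [DiscreteTopology Γ]
    (hspan : Submodule.span ℝ (lattice Γ : Set (E n)) = ⊤) (R : ℝ) :
    {ν : dualLattice Γ | ‖(ν : E n)‖ ≤ R}.Finite := by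
  obtain ⟨s, hs⟩ := exists_finset_closure_lattice (Γ := Γ)
  choose k hk using fun (ν : dualLattice Γ) (l : s) =>
    ν.2 l (hs ▸ AddSubgroup.subset_closure l.2)
  have hinj : Function.Injective k := fun a b hab => Subtype.ext <|
    injective_inner_lattice hs hspan fun l hl => by rw [hk a ⟨l, hl⟩, hk b ⟨l, hl⟩, hab]
  refine Set.Finite.of_finite_image (f := k) ?_ hinj.injOn
  refine (Set.Finite.pi' fun l : s =>
    Set.finite_Icc (-⌈R * ‖(l : E n)‖⌉) ⌈R * ‖(l : E n)‖⌉).subset ?_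
  rintro _ ⟨ν, hν, rfl⟩ l
  have h1 : |(k ν l : ℝ)| ≤ R * ‖(l : E n)‖ := by
    rw [← hk]
    exact (abs_real_inner_le_norm _ _).trans (by gcongr; exact hν)
  have h2 : |k ν l| ≤ ⌈R * ‖(l : E n)‖⌉ := by
    have := h1.trans (Int.le_ceil _)
    exact_mod_cast this
  exact abs_le.mp h2

end

/-! ### The Dirichlet domain and its tiling. -/

section

variable {n : ℕ} {Γ : Subgroup (EucIso n)} {ω₀ : E n}

/-- The group `𝓛* ⋊ Π`, realized as the group of the isometries `ω ↦ M (ω + ν)`. -/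
def dualGroup (Γ : Subgroup (EucIso n)) : Subgroup (EucIso n) where
  carrier := {g | transPart g ∈ dualLattice Γ ∧ linPart n g ∈ pointGroup Γ}
  one_mem' := by
    have : (1 : EucIso n) = isom 0 1 := by ext1 z; simp
    simp only [this, Set.mem_ofPred_eq, transPart_isom, linPart_isom]
    exact ⟨zero_mem _, one_mem _⟩
  mul_mem' {a b} ha hb := by
    rw [← isom_transPart_linPart a, ← isom_transPart_linPart b, isom_mul_isom]
    simp only [Set.mem_ofPred_eq, transPart_isom, linPart_isom]
    exact ⟨add_mem hb.1 (map_mem_dualLattice (inv_mem hb.2) ha.1), mul_mem ha.2 hb.2⟩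
  inv_mem' {a} ha := by
    rw [← isom_transPart_linPart a, isom_inv]
    simp only [Set.mem_ofPred_eq, transPart_isom, linPart_isom]
    exact ⟨neg_mem (map_mem_dualLattice ha.2 ha.1), inv_mem ha.2⟩

theorem isom_mem_dualGroup (ν : dualLattice Γ) (M : pointGroup Γ) :
    isom (ν : E n) (M : O n) ∈ dualGroup Γ := by
  change _ ∧ _
  rw [transPart_isom, linPart_isom]
  exact ⟨ν.2, M.2⟩

theorem exists_eq_isom_of_mem_dualGroup {g : EucIso n} (hg : g ∈ dualGroup Γ) :
    ∃ (ν : dualLattice Γ) (M : pointGroup Γ), g = isom (ν : E n) (M : O n) :=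
  ⟨⟨_, hg.1⟩, ⟨_, hg.2⟩, (isom_transPart_linPart g).symm⟩

theorem isom_eq_one_iff {ν : dualLattice Γ} {M : pointGroup Γ} :
    isom (ν : E n) (M : O n) = 1 ↔ (ν, M) = (0, 1) := by
  have h1 : (1 : EucIso n) = isom 0 1 := by ext1 z; simp
  constructor
  · intro h
    rw [h1] at h
    refine Prod.ext (Subtype.ext ?_) (Subtype.ext ?_)
    · simpa using congrArg transPart h
    · simpa using congrArg (linPart n) h
  · intro h
    obtain ⟨rfl, rfl⟩ := Prod.ext_iff.mp h
    exact h1.symm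

theorem mem_dirichletDomain_iff {ω : E n} :
    ω ∈ dirichletDomain Γ ω₀ ↔ ∀ g ∈ dualGroup Γ, g ≠ 1 → ‖ω - ω₀‖ < ‖ω - g ω₀‖ := by
  constructor
  · intro h g hg hne
    obtain ⟨ν, M, rfl⟩ := exists_eq_isom_of_mem_dualGroup hg
    rw [isom_apply]
    exact h ν M (mt isom_eq_one_iff.mpr hne)
  · intro h ν M hne
    have := h _ (isom_mem_dualGroup ν M) (mt isom_eq_one_iff.mp hne)
    rwa [isom_apply] at this

theorem HasTrivialStabilizer.eq_one (hω₀ : HasTrivialStabilizer Γ ω₀) {g : EucIso n}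
    (hg : g ∈ dualGroup Γ) (h : g ω₀ = ω₀) : g = 1 := by
  obtain ⟨ν, M, rfl⟩ := exists_eq_isom_of_mem_dualGroup hg
  rw [isom_apply] at h
  exact isom_eq_one_iff.mpr (hω₀ ν M h)

theorem eucIso_mul_apply (g h : EucIso n) (z : E n) : (g * h) z = g (h z) := rfl

theorem eucIso_apply_inv_apply (g : EucIso n) (z : E n) : g (g⁻¹ z) = z := g.apply_symm_apply z

theorem eucIso_inv_apply_apply (g : EucIso n) (z : E n) : g⁻¹ (g z) = z := g.symm_apply_apply z

theorem norm_map_sub_map (g : EucIso n) (a b : E n) : ‖g a - g b‖ = ‖a - b‖ := by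
  rw [← dist_eq_norm, ← dist_eq_norm, g.dist_map]

/-- If `ω` is closer to `ω₀` than to `g⁻¹ω₀`, then `gω` is closer to `gω₀` than to `ω₀`, against `gω
∈ Ω`. -/
theorem eq_one_of_mem_dirichletDomain {g : EucIso n} (hg : g ∈ dualGroup Γ) {ω : E n}
    (hω : ω ∈ dirichletDomain Γ ω₀) (hgω : g ω ∈ dirichletDomain Γ ω₀) : g = 1 := by
  by_contra hne
  rw [mem_dirichletDomain_iff] at hω hgω
  have h1 := hgω g hg hne
  have h2 := hω g⁻¹ (inv_mem hg) (inv_ne_one.mpr hne)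
  rw [norm_map_sub_map] at h1
  rw [← norm_map_sub_map g ω (g⁻¹ ω₀), eucIso_apply_inv_apply] at h2
  exact lt_asymm h1 h2

theorem eq_of_map_eq_map {g h : EucIso n} (hg : g ∈ dualGroup Γ) (hh : h ∈ dualGroup Γ)
    {ω ω' : E n} (hω : ω ∈ dirichletDomain Γ ω₀) (hω' : ω' ∈ dirichletDomain Γ ω₀)
    (he : g ω = h ω') : g = h := by
  refine (inv_mul_eq_one.mp (eq_one_of_mem_dirichletDomain (mul_mem (inv_mem hh) hg) hω ?_)).symm
  have : (h⁻¹ * g : EucIso n) ω = ω' := by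
    rw [eucIso_mul_apply, he, eucIso_inv_apply_apply]
  rwa [this]

theorem finite_dualGroup_near [DiscreteTopology Γ] [Finite (pointGroup Γ)]
    (hspan : Submodule.span ℝ (lattice Γ : Set (E n)) = ⊤) (ω₀ ω : E n) (R : ℝ) :
    {g : EucIso n | g ∈ dualGroup Γ ∧ ‖ω - g ω₀‖ ≤ R}.Finite := by
  have hfin := (Set.finite_univ (α := pointGroup Γ)).prod
    (finite_dualLattice_inter_closedBall hspan (R + ‖ω‖ + ‖ω₀‖))
  refine (hfin.image fun p => isom (p.2 : E n) (p.1 : O n)).subset ?_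
  rintro g ⟨hg, hR⟩
  obtain ⟨ν, M, rfl⟩ := exists_eq_isom_of_mem_dualGroup hg
  refine ⟨(M, ν), ⟨Set.mem_univ _, ?_⟩, rfl⟩
  rw [isom_apply] at hR
  change ‖(ν : E n)‖ ≤ _
  have h1 : ‖(M : O n) (ω₀ + ν)‖ = ‖ω₀ + (ν : E n)‖ := (M : O n).norm_map _
  have h2 := norm_sub_norm_le ((M : O n) (ω₀ + ν)) ω
  have h3 := norm_sub_le (ω₀ + (ν : E n)) ω₀
  rw [add_sub_cancel_left] at h3
  rw [norm_sub_rev] at h2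
  linarith

theorem isOpen_dirichletDomain [DiscreteTopology Γ] [Finite (pointGroup Γ)]
    (hspan : Submodule.span ℝ (lattice Γ : Set (E n)) = ⊤) :
    IsOpen (dirichletDomain Γ ω₀) := by
  rw [isOpen_iff_mem_nhds]
  intro ω hω
  rw [mem_dirichletDomain_iff] at hω
  -- Moving `ω` by less than 1 changes each of the two compared distances by less than 1, so a
  -- margin of 2 survives; only the finitely many closer orbit points need a neighbourhood.
  have hfin := finite_dualGroup_near hspan ω₀ ω (‖ω - ω₀‖ + 2)
  have h1 : ∀ᶠ ω' in nhds ω, ∀ g ∈ {g : EucIso n | g ∈ dualGroup Γ ∧ ‖ω - g ω₀‖ ≤ ‖ω - ω₀‖ + 2},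
      g ≠ 1 → ‖ω' - ω₀‖ < ‖ω' - g ω₀‖ := by
    rw [Filter.eventually_all_finite hfin]
    intro g hg
    by_cases hne : g = 1
    · simp [hne]
    · have : ∀ᶠ ω' in nhds ω, ‖ω' - ω₀‖ < ‖ω' - g ω₀‖ :=
        ContinuousAt.eventually_lt (by fun_prop) (by fun_prop) (hω g hg.1 hne)
      filter_upwards [this] with ω' h _ using h
  filter_upwards [h1, Metric.ball_mem_nhds ω one_pos] with ω' h hball
  rw [mem_dirichletDomain_iff]
  intro g hg hne
  rcases le_or_gt ‖ω - g ω₀‖ (‖ω - ω₀‖ + 2) with hle | hlt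
  · exact h g ⟨hg, hle⟩ hne
  · rw [mem_ball_iff_norm] at hball
    have h2 := norm_sub_le_norm_sub_add_norm_sub ω' ω ω₀
    have h3 := norm_sub_le_norm_sub_add_norm_sub ω ω' (g ω₀)
    rw [norm_sub_rev ω ω'] at h3
    linarith

theorem countable_dualGroup [Countable (dualLattice Γ)] [Finite (pointGroup Γ)] :
    Countable (dualGroup Γ) := by
  refine Function.Surjective.countable (f := fun p : dualLattice Γ × pointGroup Γ =>
    (⟨_, isom_mem_dualGroup p.1 p.2⟩ : dualGroup Γ)) ?_
  rintro ⟨g, hg⟩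
  obtain ⟨ν, M, rfl⟩ := exists_eq_isom_of_mem_dualGroup hg
  exact ⟨(ν, M), rfl⟩

/-- Local finiteness of the orbit gives a nearest point `gω₀`, unique because the distances differ;
then `g⁻¹θ ∈ Ω`. -/
theorem exists_mem_image_dirichletDomain [DiscreteTopology Γ] [Finite (pointGroup Γ)]
    (hspan : Submodule.span ℝ (lattice Γ : Set (E n)) = ⊤) {θ : E n}
    (hθ : ∀ g ∈ dualGroup Γ, ∀ h ∈ dualGroup Γ, g ≠ h → ‖θ - g ω₀‖ ≠ ‖θ - h ω₀‖) :
    ∃ g ∈ dualGroup Γ, θ ∈ g '' dirichletDomain Γ ω₀ := by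
  have hne : {g : EucIso n | g ∈ dualGroup Γ ∧ ‖θ - g ω₀‖ ≤ ‖θ - ω₀‖}.Nonempty :=
    ⟨1, one_mem (dualGroup Γ), le_rfl⟩
  obtain ⟨g, hg, hmin⟩ := Set.exists_min_image _ (fun g : EucIso n => ‖θ - g ω₀‖)
    (finite_dualGroup_near (Γ := Γ) hspan ω₀ θ ‖θ - ω₀‖) hne
  have hmin' : ∀ h ∈ dualGroup Γ, ‖θ - g ω₀‖ ≤ ‖θ - h ω₀‖ := by
    intro h hh
    rcases le_or_gt ‖θ - h ω₀‖ ‖θ - ω₀‖ with hle | hlt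
    · exact hmin h ⟨hh, hle⟩
    · exact hg.2.trans hlt.le
  refine ⟨g, hg.1, g⁻¹ θ, ?_, eucIso_apply_inv_apply g θ⟩
  rw [mem_dirichletDomain_iff]
  intro h hh hne1
  have hgh := mul_mem hg.1 hh
  have h2 := lt_of_le_of_ne (hmin' _ hgh)
    (hθ g hg.1 _ hgh fun he => hne1 (mul_eq_left.mp he.symm))
  rwa [eucIso_mul_apply, ← eucIso_apply_inv_apply g θ, norm_map_sub_map, norm_map_sub_map] at h2

/-- Ties in distance occur only on countably many perpendicular bisectors. They are null because
distinct group elements move `ω₀` to distinct points. -/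
theorem ae_exists_mem_image_dirichletDomain [DiscreteTopology Γ] [Finite (pointGroup Γ)]
    (hω₀ : HasTrivialStabilizer Γ ω₀) (hspan : Submodule.span ℝ (lattice Γ : Set (E n)) = ⊤) :
    ∀ᵐ θ : E n, ∃ g ∈ dualGroup Γ, θ ∈ g '' dirichletDomain Γ ω₀ := by
  have := countable_dualLattice hspan
  have hc : (dualGroup Γ : Set (EucIso n)).Countable := countable_dualGroup (Γ := Γ)
  have hne : ∀ g ∈ dualGroup Γ, ∀ h ∈ dualGroup Γ, g ≠ h → g ω₀ ≠ h ω₀ := by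
    intro g hg h hh hgh he
    refine hgh (inv_mul_eq_one.mp (hω₀.eq_one (mul_mem (inv_mem hg) hh) ?_))
    rw [eucIso_mul_apply, ← he, eucIso_inv_apply_apply]
  have hae : ∀ᵐ θ : E n, ∀ g ∈ dualGroup Γ, ∀ h ∈ dualGroup Γ, g ≠ h →
      ‖θ - g ω₀‖ ≠ ‖θ - h ω₀‖ := by
    refine (ae_ball_iff hc).mpr fun g hg => (ae_ball_iff hc).mpr fun h hh => ?_
    by_cases hgh : g = h
    · exact Filter.Eventually.of_forall fun _ hn => absurd hgh hn
    · have h0 := Measure.addHaar_affineSubspace (volume : Measure (E n))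
        (AffineSubspace.perpBisector (g ω₀) (h ω₀))
        (mt AffineSubspace.perpBisector_eq_top.mp (hne g hg h hh hgh))
      filter_upwards [measure_eq_zero_iff_ae_notMem.mp h0] with θ hθ _ he
      refine hθ ?_
      rw [SetLike.mem_coe, AffineSubspace.mem_perpBisector_iff_dist_eq, dist_eq_norm, dist_eq_norm]
      exact he
  filter_upwards [hae] with θ hθ using exists_mem_image_dirichletDomain hspan hθ

theorem map_lebesgueOn (g : EucIso n) {s : Set (E n)} (hs : MeasurableSet s) :
    (lebesgueOn s).map (fun ω : s => g ω) = volume.restrict (g '' s) := by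
  have hg : MeasurableEmbedding g := g.toHomeomorph.measurableEmbedding
  rw [show (fun ω : s => g ω) = g ∘ Subtype.val from rfl,
    ← Measure.map_map hg.measurable measurable_subtype_coe, lebesgueOn,
    map_comap_subtype_coe hs]
  exact ((measurePreserving_eucIso g).restrict_image_emb hg s).map_eq

/-- The tiling of `ℝⁿ` by the images of `Ω`, as a decomposition of Lebesgue measure. -/
theorem sum_map_tile [DiscreteTopology Γ] [Finite (pointGroup Γ)]
    (hω₀ : HasTrivialStabilizer Γ ω₀) (hspan : Submodule.span ℝ (lattice Γ : Set (E n)) = ⊤) :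
    Measure.sum (fun p : pointGroup Γ × dualLattice Γ =>
      (lebesgueOn (dirichletDomain Γ ω₀)).map
        fun ω : dirichletDomain Γ ω₀ => (p.1 : O n) ((ω : E n) + (p.2 : E n))) = volume := by
  have := countable_dualLattice hspan
  have hΩ := (isOpen_dirichletDomain (ω₀ := ω₀) hspan).measurableSet
  have h1 : ∀ p : pointGroup Γ × dualLattice Γ, (lebesgueOn (dirichletDomain Γ ω₀)).map
      (fun ω : dirichletDomain Γ ω₀ => (p.1 : O n) ((ω : E n) + (p.2 : E n))) =
      volume.restrict (isom (p.2 : E n) (p.1 : O n) '' dirichletDomain Γ ω₀) := fun p => by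
    rw [← map_lebesgueOn _ hΩ]
    simp only [isom_apply]
  simp only [h1]
  rw [← Measure.restrict_iUnion]
  · refine Measure.restrict_eq_self_of_ae_mem ?_
    filter_upwards [ae_exists_mem_image_dirichletDomain hω₀ hspan] with θ hθ
    obtain ⟨g, hg, hθ⟩ := hθ
    obtain ⟨ν, M, rfl⟩ := exists_eq_isom_of_mem_dualGroup hg
    exact Set.mem_iUnion.mpr ⟨(M, ν), hθ⟩
  · intro p q hpq
    refine Set.disjoint_left.mpr ?_
    rintro _ ⟨ω, hω, rfl⟩ ⟨ω', hω', he⟩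
    have := eq_of_map_eq_map (isom_mem_dualGroup q.2 q.1) (isom_mem_dualGroup p.2 p.1) hω' hω he
    refine hpq (Prod.ext (Subtype.ext ?_) (Subtype.ext ?_))
    · simpa using (congrArg (linPart n) this).symm
    · simpa using (congrArg transPart this).symm
  · intro p
    exact (isom (p.2 : E n) (p.1 : O n)).toHomeomorph.measurableEmbedding.measurableSet_image' hΩ

theorem pointOrbit_eq_iUnion : pointOrbit Γ ω₀ =
    ⋃ L : pointGroup Γ, isom 0 (L : O n) '' dirichletDomain Γ ω₀ := by
  ext θ
  simp [pointOrbit]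

theorem isOpen_pointOrbit [DiscreteTopology Γ] [Finite (pointGroup Γ)]
    (hspan : Submodule.span ℝ (lattice Γ : Set (E n)) = ⊤) :
    IsOpen (pointOrbit Γ ω₀) := by
  rw [pointOrbit_eq_iUnion]
  exact isOpen_iUnion fun L =>
    (isom 0 (L : O n)).toHomeomorph.isOpenMap _ (isOpen_dirichletDomain hspan)

theorem continuous_rot (L : pointGroup Γ) :
    Continuous (rot L : dirichletDomain Γ ω₀ → pointOrbit Γ ω₀) :=
  ((L : O n).continuous.comp continuous_subtype_val).subtype_mk _

/-- The inclusion of `ΠΩ` is a measurable embedding, so both measures can be compared after pushing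
them to `ℝⁿ`, where the sets `LΩ` are disjoint. -/
theorem sum_map_rot [DiscreteTopology Γ] [Finite (pointGroup Γ)]
    (hspan : Submodule.span ℝ (lattice Γ : Set (E n)) = ⊤) :
    Measure.sum (fun L : pointGroup Γ => (lebesgueOn (dirichletDomain Γ ω₀)).map (rot L)) =
      lebesgueOn (pointOrbit Γ ω₀) := by
  have hΩ := (isOpen_dirichletDomain (ω₀ := ω₀) hspan).measurableSet
  have hP := (isOpen_pointOrbit (ω₀ := ω₀) hspan).measurableSet
  have hemb := MeasurableEmbedding.subtype_coe hP
  rw [← hemb.comap_map (Measure.sum _), ← hemb.comap_map (lebesgueOn (pointOrbit Γ ω₀))]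
  congr 1
  rw [show (lebesgueOn (pointOrbit Γ ω₀)).map Subtype.val = volume.restrict (pointOrbit Γ ω₀) from
    map_comap_subtype_coe hP _, Measure.map_sum hemb.measurable.aemeasurable]
  have h1 : ∀ L : pointGroup Γ, ((lebesgueOn (dirichletDomain Γ ω₀)).map (rot L)).map
      Subtype.val = volume.restrict (isom 0 (L : O n) '' dirichletDomain Γ ω₀) := fun L => by
    rw [← map_lebesgueOn _ hΩ, Measure.map_map hemb.measurable (continuous_rot L).measurable]
    congr 1
    ext1 ω
    simp [rot]
  simp only [h1]
  rw [← Measure.restrict_iUnion]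
  · rw [pointOrbit_eq_iUnion]
  · intro p q hpq
    refine Set.disjoint_left.mpr ?_
    rintro _ ⟨ω, hω, rfl⟩ ⟨ω', hω', he⟩
    have h0 := eq_of_map_eq_map (isom_mem_dualGroup 0 q) (isom_mem_dualGroup 0 p) hω' hω he
    refine hpq (Subtype.ext ?_)
    simpa using (congrArg (linPart n) h0).symm
  · intro p
    exact (isom 0 (p : O n)).toHomeomorph.measurableEmbedding.measurableSet_image' hΩ

end

/-! ### Decomposition of `L²(ℝⁿ)` into fibres. -/

section

variable {n : ℕ} {Γ : Subgroup (EucIso n)} {ω₀ : E n}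

/-- The images of the Dirichlet domain `Ω` under `𝓛* ⋊ Π` tile `ℝⁿ` up to null sets, and its
images under `Π` tile `ΠΩ`. -/
structure IsTiling (Γ : Subgroup (EucIso n)) (ω₀ : E n) : Prop where
  finite_pointGroup : Finite (pointGroup Γ)
  countable_dualLattice : Countable (dualLattice Γ)
  isOpen_dirichletDomain : IsOpen (dirichletDomain Γ ω₀)
  isOpen_pointOrbit : IsOpen (pointOrbit Γ ω₀)
  sum_map_tile : Measure.sum (fun p : pointGroup Γ × dualLattice Γ =>
    (lebesgueOn (dirichletDomain Γ ω₀)).map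
      fun ω : dirichletDomain Γ ω₀ => (p.1 : O n) ((ω : E n) + (p.2 : E n))) = volume
  sum_map_rot : Measure.sum (fun L : pointGroup Γ =>
    (lebesgueOn (dirichletDomain Γ ω₀)).map (rot L)) = lebesgueOn (pointOrbit Γ ω₀)

/-- Discreteness, cocompactness and the trivial stabilizer enter the later arguments only through
`IsTiling`. -/
theorem IsCrystalGroup.isTiling (hΓ : IsCrystalGroup Γ) (hω₀ : HasTrivialStabilizer Γ ω₀) :
    IsTiling Γ ω₀ := by
  have := hΓ.discrete
  have hfin := CrystalShift.finite_pointGroup hω₀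
  have hspan := span_lattice_eq_top hΓ
  exact ⟨hfin, CrystalShift.countable_dualLattice hspan,
    CrystalShift.isOpen_dirichletDomain hspan, CrystalShift.isOpen_pointOrbit hspan,
    CrystalShift.sum_map_tile hω₀ hspan, CrystalShift.sum_map_rot hspan⟩

namespace IsTiling

/-- `Ω` is open, hence Polish, and a continuous injection from a Polish space maps Borel sets to
Borel sets (Lusin–Souslin). -/
theorem measurableEmbedding_rot (h : IsTiling Γ ω₀) (L : pointGroup Γ) :
    MeasurableEmbedding (rot L : dirichletDomain Γ ω₀ → pointOrbit Γ ω₀) := by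
  have := h.isOpen_dirichletDomain.polishSpace
  exact (continuous_rot L).measurableEmbedding fun _ _ he => (rot_inj he).2

theorem measurableEmbedding_tile (h : IsTiling Γ ω₀) (L : pointGroup Γ) (ν : dualLattice Γ) :
    MeasurableEmbedding
      fun ω : dirichletDomain Γ ω₀ => (L : O n) ((ω : E n) + (ν : E n)) := by
  have := h.isOpen_dirichletDomain.polishSpace
  refine Continuous.measurableEmbedding (by fun_prop) fun a b hab => Subtype.ext ?_
  simpa using hab

theorem ae_pointOrbit_iff (h : IsTiling Γ ω₀) {p : pointOrbit Γ ω₀ → Prop} :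
    (∀ᵐ θ ∂lebesgueOn (pointOrbit Γ ω₀), p θ) ↔
      ∀ᵐ ω ∂lebesgueOn (dirichletDomain Γ ω₀), ∀ L : pointGroup Γ, p (rot L ω) := by
  have := h.finite_pointGroup
  rw [← h.sum_map_rot, Measure.ae_sum_iff, ae_all_iff]
  simp only [(h.measurableEmbedding_rot _).ae_map_iff]

theorem ae_tile (h : IsTiling Γ ω₀) {p : E n → Prop} (hp : ∀ᵐ θ, p θ) :
    ∀ᵐ ω : dirichletDomain Γ ω₀ ∂lebesgueOn (dirichletDomain Γ ω₀),
      ∀ (L : pointGroup Γ) (ν : dualLattice Γ), p ((L : O n) ((ω : E n) + (ν : E n))) := by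
  have := h.finite_pointGroup
  have := h.countable_dualLattice
  rw [← h.sum_map_tile, Measure.ae_sum_iff] at hp
  rw [ae_all_iff]
  intro L
  rw [ae_all_iff]
  intro ν
  exact (h.measurableEmbedding_tile L ν).ae_map_iff.mp (hp (L, ν))

theorem lintegral_pointOrbit (h : IsTiling Γ ω₀) (f : pointOrbit Γ ω₀ → ENNReal) :
    ∫⁻ θ, f θ ∂lebesgueOn (pointOrbit Γ ω₀) =
      ∑' L : pointGroup Γ, ∫⁻ ω, f (rot L ω) ∂lebesgueOn (dirichletDomain Γ ω₀) := by
  rw [← h.sum_map_rot, lintegral_sum_measure]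
  simp only [(h.measurableEmbedding_rot _).lintegral_map]

theorem lintegral_tile (h : IsTiling Γ ω₀) (f : E n → ENNReal) :
    ∫⁻ θ, f θ = ∑' (L : pointGroup Γ) (ν : dualLattice Γ),
      ∫⁻ ω : dirichletDomain Γ ω₀, f ((L : O n) ((ω : E n) + (ν : E n)))
        ∂lebesgueOn (dirichletDomain Γ ω₀) := by
  conv_lhs => rw [← h.sum_map_tile, lintegral_sum_measure]
  simp only [(h.measurableEmbedding_tile _ _).lintegral_map]
  exact ENNReal.tsum_prod (f := fun (L : pointGroup Γ) (ν : dualLattice Γ) =>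
    ∫⁻ ω : dirichletDomain Γ ω₀, f ((L : O n) ((ω : E n) + (ν : E n))) ∂lebesgueOn (dirichletDomain Γ ω₀))

end IsTiling

theorem enorm_sq_eq_tsum {ι : Type*} (h : lp (fun _ : ι => ℂ) 2) :
    ‖h‖ₑ ^ (2 : ℝ) = ∑' i, ‖h i‖ₑ ^ (2 : ℝ) := by
  have h1 := lp.norm_rpow_eq_tsum (p := 2) (by norm_num) h
  have h2 := (memℓp_gen_iff (p := 2) (by norm_num)).mp (lp.memℓp h)
  simp only [ENNReal.toReal_ofNat] at h1 h2
  simp only [← ofReal_norm]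
  rw [ENNReal.ofReal_rpow_of_nonneg (norm_nonneg _) (by norm_num), h1,
    ENNReal.ofReal_tsum_of_nonneg (fun _ => by positivity) h2]
  simp only [ENNReal.ofReal_rpow_of_nonneg (norm_nonneg _) (show (0 : ℝ) ≤ 2 by norm_num)]

theorem memℓp_two_of_tsum_enorm_lt_top {ι : Type*} {f : ι → ℂ}
    (h : ∑' i, ‖f i‖ₑ ^ (2 : ℝ) < ⊤) : Memℓp f 2 := by
  rw [memℓp_gen_iff (by norm_num)]
  have h1 : ∀ i, ‖f i‖ₑ ^ (2 : ℝ) = ((‖f i‖₊ ^ (2 : ℝ) : NNReal) : ENNReal) := fun i => by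
    rw [ENNReal.coe_rpow_of_nonneg _ (by norm_num), enorm_eq_nnnorm]
  simp only [h1] at h
  have h2 := ENNReal.tsum_coe_ne_top_iff_summable.mp h.ne
  rw [← NNReal.summable_coe] at h2
  simpa using h2

open Classical in
/-- The fibre `(g (L (ω + ν)))_ν ∈ ℓ²(𝓛*)` of `g` at the point `Lω` of `ΠΩ`. -/
noncomputable def fiber (g : E n → ℂ) (θ : pointOrbit Γ ω₀) : ell2 Γ :=
  if h : Memℓp (fun ν : dualLattice Γ => g ((rotPart θ : O n) ((basePart θ : E n) + (ν : E n)))) 2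
  then ⟨_, h⟩ else 0

theorem rotPart_rot (L : pointGroup Γ) (ω : dirichletDomain Γ ω₀) : rotPart (rot L ω) = L :=
  (rot_inj (rot_rotPart_basePart (rot L ω))).1

theorem basePart_rot (L : pointGroup Γ) (ω : dirichletDomain Γ ω₀) : basePart (rot L ω) = ω :=
  (rot_inj (rot_rotPart_basePart (rot L ω))).2

theorem fiber_rot {g : E n → ℂ} {L : pointGroup Γ} {ω : dirichletDomain Γ ω₀}
    (h : Memℓp (fun ν : dualLattice Γ => g ((L : O n) ((ω : E n) + (ν : E n)))) 2)
    (ν : dualLattice Γ) : fiber g (rot L ω) ν = g ((L : O n) ((ω : E n) + (ν : E n))) := by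
  rw [fiber, rotPart_rot, basePart_rot, dif_pos h]

namespace IsTiling

theorem aemeasurable_tile (h : IsTiling Γ ω₀) {g : E n → ℂ} (hg : AEStronglyMeasurable g)
    (L : pointGroup Γ) (ν : dualLattice Γ) :
    AEStronglyMeasurable (fun ω : dirichletDomain Γ ω₀ => g ((L : O n) ((ω : E n) + (ν : E n))))
      (lebesgueOn (dirichletDomain Γ ω₀)) := by
  have := h.finite_pointGroup
  have := h.countable_dualLattice
  rw [← h.sum_map_tile, aestronglyMeasurable_sum_measure_iff] at hg
  exact (h.measurableEmbedding_tile L ν).aestronglyMeasurable_map_iff.mp (hg (L, ν))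

theorem lintegral_tsum_tile (h : IsTiling Γ ω₀) {g : E n → ℂ} (hg : AEStronglyMeasurable g) :
    ∫⁻ θ, ‖g θ‖ₑ ^ (2 : ℝ) = ∑' L : pointGroup Γ, ∫⁻ ω : dirichletDomain Γ ω₀,
      ∑' ν : dualLattice Γ, ‖g ((L : O n) ((ω : E n) + (ν : E n)))‖ₑ ^ (2 : ℝ)
        ∂lebesgueOn (dirichletDomain Γ ω₀) := by
  have := h.countable_dualLattice
  rw [h.lintegral_tile]
  refine tsum_congr fun L => ?_
  rw [lintegral_tsum fun ν => (h.aemeasurable_tile hg L ν).enorm.pow_const _]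

/-- By Tonelli over the tiles the sum of squares has finite integral over `Ω`, so it is finite
almost everywhere. The default value 0 of `fiber` thus matters only on a null set. -/
theorem ae_memℓp (h : IsTiling Γ ω₀) {g : E n → ℂ} (hg : MemLp g 2) :
    ∀ᵐ ω : dirichletDomain Γ ω₀ ∂lebesgueOn (dirichletDomain Γ ω₀), ∀ L : pointGroup Γ,
      Memℓp (fun ν : dualLattice Γ => g ((L : O n) ((ω : E n) + (ν : E n)))) 2 := by
  have := h.finite_pointGroup
  have := h.countable_dualLattice
  have h1 : ∫⁻ θ, ‖g θ‖ₑ ^ (2 : ℝ) < ⊤ := by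
    have := lintegral_rpow_enorm_lt_top_of_eLpNorm_lt_top (by norm_num) (by norm_num) hg.2
    simpa using this
  rw [h.lintegral_tsum_tile hg.1] at h1
  rw [ae_all_iff]
  intro L
  have h2 := (ENNReal.le_tsum L).trans_lt h1
  filter_upwards [ae_lt_top' (AEMeasurable.tsum fun ν =>
    (h.aemeasurable_tile hg.1 L ν).enorm.pow_const _) h2.ne] with ω hω
  exact memℓp_two_of_tsum_enorm_lt_top hω

theorem ae_fiber (h : IsTiling Γ ω₀) {g : E n → ℂ} (hg : MemLp g 2) :
    ∀ᵐ ω : dirichletDomain Γ ω₀ ∂lebesgueOn (dirichletDomain Γ ω₀),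
      ∀ (L : pointGroup Γ) (ν : dualLattice Γ),
        fiber g (rot L ω) ν = g ((L : O n) ((ω : E n) + (ν : E n))) := by
  filter_upwards [h.ae_memℓp hg] with ω hω L ν using fiber_rot (hω L) ν

/-- The fibre is the a.e. limit of its finite partial sums; as `𝓛*` is countable, the filter of
finite subsets is countably generated and the limit stays measurable. -/
theorem aestronglyMeasurable_fiber (h : IsTiling Γ ω₀) {g : E n → ℂ} (hg : MemLp g 2) :
    AEStronglyMeasurable (fiber g : pointOrbit Γ ω₀ → ell2 Γ) (lebesgueOn (pointOrbit Γ ω₀)) := by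
  classical
  have := h.finite_pointGroup
  have := h.countable_dualLattice
  rw [← h.sum_map_rot, aestronglyMeasurable_sum_measure_iff]
  intro L
  rw [(h.measurableEmbedding_rot L).aestronglyMeasurable_map_iff]
  refine aestronglyMeasurable_of_tendsto_ae (Filter.atTop : Filter (Finset (dualLattice Γ)))
    (f := fun s (ω : dirichletDomain Γ ω₀) =>
      ∑ ν ∈ s, g ((L : O n) ((ω : E n) + (ν : E n))) • lp.single 2 ν (1 : ℂ)) ?_ ?_
  · exact fun s => Finset.aestronglyMeasurable_fun_sum _ fun ν _ =>
      (h.aemeasurable_tile hg.1 L ν).smul_const _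
  · filter_upwards [h.ae_fiber hg] with ω hω
    have h1 := lp.hasSum_single (p := 2) (by norm_num) (fiber g (rot L ω) : ell2 Γ)
    refine h1.congr fun s => Finset.sum_congr rfl fun ν _ => ?_
    have h2 := lp.single_smul (E := fun _ : dualLattice Γ => ℂ) 2 ν
      (g ((L : O n) ((ω : E n) + (ν : E n)))) (1 : ℂ)
    rw [smul_eq_mul, mul_one] at h2
    exact (congrArg (lp.single 2 ν) (hω L ν)).trans h2

theorem eLpNorm_fiber (h : IsTiling Γ ω₀) {g : E n → ℂ} (hg : MemLp g 2) :
    eLpNorm (fiber g : pointOrbit Γ ω₀ → ell2 Γ) 2 (lebesgueOn (pointOrbit Γ ω₀)) =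
      eLpNorm g 2 := by
  have key : eLpNorm (fiber g : pointOrbit Γ ω₀ → ell2 Γ) 2 (lebesgueOn (pointOrbit Γ ω₀)) ^ (2 : ℝ)
      = eLpNorm g 2 ^ (2 : ℝ) := by
    have h1 := eLpNorm_nnreal_pow_eq_lintegral (μ := lebesgueOn (pointOrbit Γ ω₀))
      (f := (fiber g : pointOrbit Γ ω₀ → ell2 Γ)) (p := 2) two_ne_zero
    have h2 := eLpNorm_nnreal_pow_eq_lintegral (μ := volume) (f := g) (p := 2) two_ne_zero
    simp only [NNReal.coe_ofNat, ENNReal.coe_ofNat] at h1 h2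
    rw [h1, h2, h.lintegral_tsum_tile hg.1, h.lintegral_pointOrbit]
    refine tsum_congr fun L => lintegral_congr_ae ?_
    filter_upwards [h.ae_fiber hg] with ω hω
    rw [enorm_sq_eq_tsum]
    simp only [hω]
  exact ENNReal.rpow_left_injective two_ne_zero key

theorem memLp_fiber (h : IsTiling Γ ω₀) {g : E n → ℂ} (hg : MemLp g 2) :
    MemLp (fiber g : pointOrbit Γ ω₀ → ell2 Γ) 2 (lebesgueOn (pointOrbit Γ ω₀)) :=
  ⟨h.aestronglyMeasurable_fiber hg, by rw [h.eLpNorm_fiber hg]; exact hg.2⟩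

theorem ae_eq_of_ae_coeff (h : IsTiling Γ ω₀) {F G : pointOrbit Γ ω₀ → ell2 Γ}
    (hFG : ∀ᵐ ω : dirichletDomain Γ ω₀ ∂lebesgueOn (dirichletDomain Γ ω₀),
      ∀ (L : pointGroup Γ) (ν : dualLattice Γ), F (rot L ω) ν = G (rot L ω) ν) :
    F =ᵐ[lebesgueOn (pointOrbit Γ ω₀)] G := by
  refine h.ae_pointOrbit_iff.mpr ?_
  filter_upwards [hFG] with ω hω L
  exact lp.ext (funext (hω L))

theorem ae_toLp_fiber (h : IsTiling Γ ω₀) (g : L2 n) :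
    ∀ᵐ ω : dirichletDomain Γ ω₀ ∂lebesgueOn (dirichletDomain Γ ω₀),
      ∀ (L : pointGroup Γ) (ν : dualLattice Γ),
        (h.memLp_fiber (Lp.memLp g)).toLp (fiber g) (rot L ω) ν =
          g ((L : O n) ((ω : E n) + (ν : E n))) := by
  filter_upwards [h.ae_fiber (Lp.memLp g),
    h.ae_pointOrbit_iff.mp (h.memLp_fiber (Lp.memLp g)).coeFn_toLp] with ω h1 h2 L ν
  rw [h2 L, h1 L ν]

/-- The decomposition of `L²(ℝⁿ)` along the tiling: the isometry from `L²(ℝⁿ)` to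
`L²(ΠΩ, ℓ²(𝓛*))` that maps `g` to `Lω ↦ (g (L (ω + ν)))_ν`. -/
noncomputable def decomp (h : IsTiling Γ ω₀) :
    L2 n →ₗᵢ[ℂ] Lp (ell2 Γ) 2 (lebesgueOn (pointOrbit Γ ω₀)) where
  toFun g := (h.memLp_fiber (Lp.memLp g)).toLp (fiber g)
  map_add' f g := by
    refine Lp.ext (h.ae_eq_of_ae_coeff ?_)
    filter_upwards [h.ae_toLp_fiber (f + g), h.ae_toLp_fiber f, h.ae_toLp_fiber g,
      h.ae_tile (Lp.coeFn_add f g), h.ae_pointOrbit_iff.mp (Lp.coeFn_add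
        ((h.memLp_fiber (Lp.memLp f)).toLp (fiber f))
        ((h.memLp_fiber (Lp.memLp g)).toLp (fiber g)))] with ω h1 h2 h3 h4 h5 L ν
    rw [h1, h5, h4, Pi.add_apply, Pi.add_apply, lp.coeFn_add, Pi.add_apply, h2, h3]
  map_smul' c f := by
    refine Lp.ext (h.ae_eq_of_ae_coeff ?_)
    filter_upwards [h.ae_toLp_fiber (c • f), h.ae_toLp_fiber f,
      h.ae_tile (Lp.coeFn_smul c f), h.ae_pointOrbit_iff.mp (Lp.coeFn_smul c
        ((h.memLp_fiber (Lp.memLp f)).toLp (fiber f)))] with ω h1 h2 h4 h5 L ν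
    rw [h1, RingHom.id_apply, h5, h4, Pi.smul_apply, Pi.smul_apply, lp.coeFn_smul, Pi.smul_apply,
      h2]
  norm_map' g := by
    change ‖(h.memLp_fiber (Lp.memLp g)).toLp (fiber g)‖ = ‖g‖
    rw [Lp.norm_toLp, h.eLpNorm_fiber (Lp.memLp g), Lp.norm_def]

theorem ae_decomp (h : IsTiling Γ ω₀) (g : L2 n) :
    ∀ᵐ ω : dirichletDomain Γ ω₀ ∂lebesgueOn (dirichletDomain Γ ω₀),
      ∀ (L : pointGroup Γ) (ν : dualLattice Γ),
        h.decomp g (rot L ω) ν = g ((L : O n) ((ω : E n) + (ν : E n))) :=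
  h.ae_toLp_fiber g

end IsTiling

end

/-! ### The Fourier transform of a shift. -/

section

open FourierTransform SchwartzMap

variable {n : ℕ}

theorem coeFn_shift (g : EucIso n) (f : L2 n) : shift g f =ᵐ[volume] f ∘ (g⁻¹ : EucIso n) :=
  Lp.coeFn_compMeasurePreserving f (measurePreserving_eucIso g⁻¹)

/-- The unimodular factor `ω ↦ e^{2πi ω·y}`. -/
noncomputable def modulation (y ω : E n) : ℂ :=
  Complex.exp ((2 * Real.pi * inner ℝ ω y : ℝ) * Complex.I)

theorem norm_modulation (y ω : E n) : ‖modulation y ω‖ = 1 :=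
  Complex.norm_exp_ofReal_mul_I _

theorem continuous_modulation (y : E n) : Continuous (modulation y) := by
  unfold modulation
  fun_prop

theorem memLp_modulation_mul (y : E n) (f : L2 n) :
    MemLp (fun ω => modulation y ω * f ω) 2 :=
  (Lp.memLp f).of_le ((continuous_modulation y).aestronglyMeasurable.mul
    (Lp.aestronglyMeasurable f)) (.of_forall fun ω => by
      change ‖modulation y ω * f ω‖ ≤ _
      rw [norm_mul, norm_modulation, one_mul])

/-- Multiplication by `e^{2πi ω·y}` on `L²(ℝⁿ)`. -/
noncomputable def modulate (y : E n) : L2 n →ₗ[ℂ] L2 n where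
  toFun f := (memLp_modulation_mul y f).toLp _
  map_add' f g := by
    ext1
    refine (MemLp.coeFn_toLp _).trans (.trans ?_ (Lp.coeFn_add _ _).symm)
    filter_upwards [Lp.coeFn_add f g, (memLp_modulation_mul y f).coeFn_toLp,
      (memLp_modulation_mul y g).coeFn_toLp] with ω h1 h2 h3
    rw [Pi.add_apply, h1, h2, h3, Pi.add_apply]
    exact mul_add _ _ _
  map_smul' c f := by
    ext1
    refine (MemLp.coeFn_toLp _).trans (.trans ?_ (Lp.coeFn_smul _ _).symm)
    filter_upwards [Lp.coeFn_smul c f, (memLp_modulation_mul y f).coeFn_toLp] with ω h1 h2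
    rw [RingHom.id_apply, Pi.smul_apply, h1, h2, Pi.smul_apply]
    exact mul_left_comm _ _ _

theorem coeFn_modulate (y : E n) (f : L2 n) :
    modulate y f =ᵐ[volume] fun ω => modulation y ω * f ω :=
  (memLp_modulation_mul y f).coeFn_toLp

theorem continuous_modulate (y : E n) : Continuous (modulate y) := by
  refine AddMonoidHomClass.continuous_of_bound (modulate y) 1 fun f => ?_
  rw [one_mul]
  refine Lp.norm_le_norm_of_ae_le ?_
  filter_upwards [coeFn_modulate y f] with ω hω
  rw [hω, norm_mul, norm_modulation, one_mul]

theorem continuous_shift (g : EucIso n) : Continuous (shift g) :=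
  (Lp.compMeasurePreservingₗᵢ ℂ _ (measurePreserving_eucIso g⁻¹) : L2 n →ₗᵢ[ℂ] L2 n).continuous

theorem isom_inv_apply (x : E n) (M : O n) (z : E n) : (isom x M)⁻¹ z = M.symm z - x := by
  have h : isom x M (M.symm z - x) = z := by simp
  change (isom x M).symm z = _
  rw [AffineIsometryEquiv.symm_apply_eq, h]

/-- Substitute `M (z + x)` for `z`; the exponent splits because `M` preserves inner products. -/
theorem fourierInv_comp_isom_inv (f : E n → ℂ) (x : E n) (M : O n) (ω : E n) :
    𝓕⁻ (fun z => f (M.symm z - x)) ω = modulation (M x) ω * 𝓕⁻ f (M.symm ω) := by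
  rw [Real.fourierInv_eq', Real.fourierInv_eq',
    ← (measurePreserving_eucIso (isom x M)).integral_comp
      (isom x M).toHomeomorph.measurableEmbedding, ← integral_const_mul]
  congr 1
  ext z
  rw [isom_apply, LinearIsometryEquiv.symm_apply_apply, add_sub_cancel_right, smul_eq_mul,
    smul_eq_mul, ← mul_assoc, modulation, ← Complex.exp_add]
  congr 2
  have h1 : inner ℝ (M (z + x)) ω = inner ℝ ω (M x) + inner ℝ z (M.symm ω) := by
    rw [map_add, inner_add_left, real_inner_comm ω (M x), add_comm]
    congr 1
    rw [← M.inner_map_map z (M.symm ω), M.apply_symm_apply]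
  rw [h1]
  push_cast
  ring

/-- Both sides are continuous in `f`, so it is enough to treat Schwartz functions, for which the
transform is an integral. -/
theorem hat_shift_eq_modulate (x : E n) (M : O n) (f : L2 n) :
    hat (shift (isom x M) f) = modulate (M x) (shift (isom 0 M) (hat f)) := by
  refine DenseRange.induction_on (SchwartzMap.denseRange_toLpCLM (p := 2) ENNReal.ofNat_ne_top) f
    (isClosed_eq ?_ ?_) ?_
  · exact (Lp.fourierTransformₗᵢ (E n) ℂ).symm.continuous.comp (continuous_shift _)
  · exact (continuous_modulate _).comp ((continuous_shift _).comp
      (Lp.fourierTransformₗᵢ (E n) ℂ).symm.continuous)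
  intro φ
  let ψ : 𝓢(E n, ℂ) := compCLMOfContinuousLinearEquiv ℂ M.symm.toContinuousLinearEquiv
    (compSubConstCLM ℂ x φ)
  have hψ : ∀ z, ψ z = φ (M.symm z - x) := fun z => rfl
  have h1 : shift (isom x M) (φ.toLp 2) = ψ.toLp 2 := by
    ext1
    have hq := (measurePreserving_eucIso (isom x M)⁻¹).quasiMeasurePreserving.ae_eq_comp
      (φ.coeFn_toLp 2 volume)
    filter_upwards [coeFn_shift (isom x M) (φ.toLp 2), ψ.coeFn_toLp 2 volume, hq] with z h1 h2 h3
    rw [h1, h2, h3, hψ, Function.comp_apply, isom_inv_apply]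
  change hat (shift (isom x M) (φ.toLp 2)) = modulate (M x) (shift (isom 0 M) (hat (φ.toLp 2)))
  rw [h1, hat, hat, SchwartzMap.toLp_fourierInv_eq, SchwartzMap.toLp_fourierInv_eq]
  ext1
  have hq := (measurePreserving_eucIso (isom 0 M)⁻¹).quasiMeasurePreserving.ae_eq_comp
      ((𝓕⁻ φ).coeFn_toLp 2 volume)
  filter_upwards [(𝓕⁻ ψ).coeFn_toLp 2 volume, coeFn_modulate (M x)
    (shift (isom 0 M) ((𝓕⁻ φ).toLp 2)), coeFn_shift (isom 0 M) ((𝓕⁻ φ).toLp 2), hq]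
    with ω h1 h2 h3 h4
  rw [h1, h2, h3, h4, Function.comp_apply, isom_inv_apply, sub_zero, fourierInv_coe, fourierInv_coe]
  exact fourierInv_comp_isom_inv φ x M ω

theorem hat_shift (x : E n) (M : O n) (f : L2 n) :
    ∀ᵐ ω : E n, hat (shift (isom x M) f) ω = modulation (M x) ω * hat f (M.symm ω) := by
  rw [hat_shift_eq_modulate]
  filter_upwards [coeFn_modulate (M x) (shift (isom 0 M) (hat f)), coeFn_shift (isom 0 M) (hat f)]
    with ω h1 h2
  rw [h1, h2, Function.comp_apply, isom_inv_apply, sub_zero]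

end

/-! ### Uniqueness of Fourier coefficients on `ΠΩ`. -/

section

variable {n : ℕ} {Γ : Subgroup (EucIso n)} {ω₀ : E n}

theorem modulation_add_left (y z ω : E n) :
    modulation (y + z) ω = modulation y ω * modulation z ω := by
  rw [modulation, modulation, modulation, ← Complex.exp_add, inner_add_right]
  congr 1
  push_cast
  ring

theorem modulation_add_right (y ω ω' : E n) :
    modulation y (ω + ω') = modulation y ω * modulation y ω' := by
  rw [modulation, modulation, modulation, ← Complex.exp_add, inner_add_left]
  congr 1
  push_cast
  ring

@[simp] theorem modulation_zero_left (ω : E n) : modulation 0 ω = 1 := by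
  simp [modulation]

theorem star_modulation (y ω : E n) : star (modulation y ω) = modulation (-y) ω := by
  rw [modulation, modulation, ← starRingEnd_apply, ← Complex.exp_conj, map_mul,
    Complex.conj_ofReal, Complex.conj_I, inner_neg_right]
  congr 1
  push_cast
  ring

theorem modulation_eq_modulation_iff {y ω ω' : E n} :
    modulation y ω = modulation y ω' ↔ ∃ k : ℤ, inner ℝ (ω - ω') y = (k : ℝ) := by
  rw [modulation, modulation, Complex.exp_eq_exp_iff_exists_int]
  refine exists_congr fun k => ?_
  rw [inner_sub_left]
  have h : (2 * Real.pi * Complex.I : ℂ) ≠ 0 := Complex.two_pi_I_ne_zero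
  constructor
  · intro hk
    have h1 : (2 * Real.pi * Complex.I : ℂ) * ((inner ℝ ω y - inner ℝ ω' y : ℝ) : ℂ) =
        (2 * Real.pi * Complex.I : ℂ) * ((k : ℝ) : ℂ) := by
      push_cast at hk ⊢
      linear_combination hk
    exact_mod_cast mul_left_cancel₀ h h1
  · intro hk
    rw [sub_eq_iff_eq_add] at hk
    rw [hk]
    push_cast
    ring

/-- Equal values of all characters put `θ - θ'` in `𝓛*`. Then `θ` lies in the tile of `L` with shift
0 and in a tile of `L'` shifted by `L'⁻¹(θ - θ')`, so disjointness makes the shift zero. -/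
theorem eq_of_forall_modulation_eq {θ θ' : pointOrbit Γ ω₀}
    (h : ∀ l ∈ lattice Γ, modulation l (θ : E n) = modulation l (θ' : E n)) : θ = θ' := by
  have hν : (θ : E n) - θ' ∈ dualLattice Γ := fun l hl =>
    modulation_eq_modulation_iff.mp (h l hl)
  obtain ⟨_, L, ω, rfl⟩ := θ
  obtain ⟨_, L', ω', rfl⟩ := θ'
  refine Subtype.ext ?_
  have hν' := map_mem_dualLattice (inv_mem L'.2) hν
  have h1 : isom ((0 : dualLattice Γ) : E n) (L : O n) ω =
      isom ((⟨_, hν'⟩ : dualLattice Γ) : E n) (L' : O n) ω' := by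
    simp [LinearIsometryEquiv.inv_def]
  have h2 := congrArg transPart
    (eq_of_map_eq_map (isom_mem_dualGroup _ _) (isom_mem_dualGroup _ _) ω.2 ω'.2 h1)
  rw [transPart_isom, transPart_isom] at h2
  exact sub_eq_zero.mp (((L'⁻¹ : pointGroup Γ) : O n).map_eq_zero_iff.mp h2.symm)

/-- The character `θ ↦ e^{2πi θ·l}` as a bounded continuous function on `ΠΩ`. -/
noncomputable def character (Γ : Subgroup (EucIso n)) (ω₀ l : E n) :
    BoundedContinuousFunction (pointOrbit Γ ω₀) ℂ :=
  BoundedContinuousFunction.ofNormedAddCommGroup (fun θ => modulation l (θ : E n))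
    ((continuous_modulation l).comp continuous_subtype_val) 1 fun _ => (norm_modulation _ _).le

/-- The trigonometric polynomials on `ΠΩ` with frequencies in `𝓛`. -/
noncomputable def trigPoly (Γ : Subgroup (EucIso n)) (ω₀ : E n) :
    StarSubalgebra ℂ (BoundedContinuousFunction (pointOrbit Γ ω₀) ℂ) :=
  StarAlgebra.adjoin ℂ (character Γ ω₀ '' lattice Γ)

theorem trigPoly_separatesPoints :
    ((trigPoly Γ ω₀).map
      (BoundedContinuousFunction.toContinuousMapStarₐ ℂ)).SeparatesPoints := by
  intro θ θ' hne
  by_contra! hall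
  refine hne (eq_of_forall_modulation_eq fun l hl => ?_)
  exact hall _ ⟨_, ⟨character Γ ω₀ l, StarAlgebra.subset_adjoin _ _ ⟨l, hl, rfl⟩, rfl⟩, rfl⟩

/-- Characters are closed under products and conjugation and include 1, so the star algebra they
generate is their linear span. -/
theorem mem_span_character_of_mem_trigPoly
    {f : BoundedContinuousFunction (pointOrbit Γ ω₀) ℂ} (hf : f ∈ trigPoly Γ ω₀) :
    f ∈ Submodule.span ℂ (character Γ ω₀ '' lattice Γ) := by
  have h : f ∈ Subalgebra.toSubmodule (trigPoly Γ ω₀).toSubalgebra := hf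
  rw [trigPoly, StarAlgebra.adjoin_eq_span] at h
  refine Submodule.span_mono ?_ h
  intro g hg
  induction hg using Submonoid.closure_induction with
  | mem g hg =>
    rcases hg with hg | ⟨l, hl, he⟩
    · exact hg
    · refine ⟨-l, neg_mem hl, ?_⟩
      rw [← star_star g, ← he]
      ext θ
      exact (star_modulation l θ).symm
  | one => exact ⟨0, zero_mem _, by ext θ; exact modulation_zero_left _⟩
  | mul a b _ _ ha hb =>
    obtain ⟨l, hl, rfl⟩ := ha
    obtain ⟨m, hm, rfl⟩ := hb
    exact ⟨l + m, add_mem hl hm, by ext θ; exact modulation_add_left _ _ _⟩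

namespace IsTiling

/-- The positive and negative parts of `v` are densities of finite measures with equal integrals
over a star algebra that separates points; on a Polish space the two measures then coincide. -/
theorem ae_eq_zero_of_integral_modulation_real (h : IsTiling Γ ω₀) {v : pointOrbit Γ ω₀ → ℝ}
    (hv : Integrable v (lebesgueOn (pointOrbit Γ ω₀)))
    (h0 : ∀ l ∈ lattice Γ,
      ∫ θ : pointOrbit Γ ω₀, modulation l (θ : E n) * (v θ : ℂ) ∂lebesgueOn (pointOrbit Γ ω₀) = 0) :
    v =ᵐ[lebesgueOn (pointOrbit Γ ω₀)] 0 := by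
  set μ := lebesgueOn (pointOrbit Γ ω₀)
  have := h.isOpen_pointOrbit.polishSpace
  have hfin := isFiniteMeasure_withDensity_ofReal hv.2
  have hfin' := isFiniteMeasure_withDensity_ofReal hv.neg.2
  have hm : AEMeasurable (fun θ => ENNReal.ofReal (v θ)) μ := hv.aemeasurable.ennreal_ofReal
  have hm' : AEMeasurable (fun θ => ENNReal.ofReal ((-v) θ)) μ :=
    hv.neg.aemeasurable.ennreal_ofReal
  have hint : ∀ f : BoundedContinuousFunction (pointOrbit Γ ω₀) ℂ,
      Integrable (fun θ => f θ * (v θ : ℂ)) μ := fun f =>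
    hv.ofReal.bdd_mul f.continuous.aestronglyMeasurable (.of_forall f.norm_coe_le_norm)
  have hsmul : ∀ (f : BoundedContinuousFunction (pointOrbit Γ ω₀) ℂ) (w : pointOrbit Γ ω₀ → ℝ),
      Integrable w μ → Integrable (fun θ => w θ • f θ) μ := fun f w hw =>
    hw.smul_bdd _ f.continuous.aestronglyMeasurable (.of_forall f.norm_coe_le_norm)
  have hspan : ∀ f ∈ Submodule.span ℂ (character Γ ω₀ '' lattice Γ),
      ∫ θ, f θ * (v θ : ℂ) ∂μ = 0 := by
    intro f hf
    induction hf using Submodule.span_induction with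
    | mem f hf =>
      obtain ⟨l, hl, rfl⟩ := hf
      exact h0 l hl
    | zero => simp
    | add f g _ _ hf hg =>
      simp only [BoundedContinuousFunction.coe_add, Pi.add_apply, add_mul]
      rw [integral_add (hint f) (hint g), hf, hg, add_zero]
    | smul c f _ hf =>
      simp only [BoundedContinuousFunction.coe_smul, smul_eq_mul, mul_assoc]
      rw [integral_const_mul, hf, mul_zero]
  have heq : μ.withDensity (fun θ => ENNReal.ofReal (v θ)) =
      μ.withDensity (fun θ => ENNReal.ofReal ((-v) θ)) := by
    refine ext_of_forall_mem_subalgebra_integral_eq_of_polish (𝕜 := ℂ)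
      (A := trigPoly Γ ω₀) trigPoly_separatesPoints fun f hf => ?_
    rw [integral_withDensity_eq_integral_toReal_smul₀ hm
        (.of_forall fun _ => ENNReal.ofReal_lt_top),
      integral_withDensity_eq_integral_toReal_smul₀ hm' (.of_forall fun _ => ENNReal.ofReal_lt_top),
      ← sub_eq_zero, ← integral_sub, ← hspan f (mem_span_character_of_mem_trigPoly hf)]
    · refine integral_congr_ae (.of_forall fun θ => ?_)
      simp only [ENNReal.toReal_ofReal', Pi.neg_apply, ← sub_smul]
      rw [max_zero_sub_eq_self, Complex.real_smul, mul_comm]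
    · simp only [ENNReal.toReal_ofReal']
      exact hsmul f _ hv.pos_part
    · simp only [ENNReal.toReal_ofReal']
      exact hsmul f _ hv.neg.pos_part
  have := (withDensity_eq_iff hm hm' hv.lintegral_lt_top.ne).mp heq
  filter_upwards [this] with θ hθ
  have h1 := congrArg ENNReal.toReal hθ
  rw [ENNReal.toReal_ofReal', ENNReal.toReal_ofReal', Pi.neg_apply, ← sub_eq_zero,
    max_zero_sub_eq_self] at h1
  exact h1

/-- Uniqueness of Fourier coefficients on the fundamental domain `ΠΩ` of `ℝⁿ / 𝓛*`. -/
theorem ae_eq_zero_of_integral_modulation (h : IsTiling Γ ω₀) {u : pointOrbit Γ ω₀ → ℂ}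
    (hu : Integrable u (lebesgueOn (pointOrbit Γ ω₀)))
    (h0 : ∀ l ∈ lattice Γ,
      ∫ θ : pointOrbit Γ ω₀, modulation l (θ : E n) * u θ ∂lebesgueOn (pointOrbit Γ ω₀) = 0) :
    u =ᵐ[lebesgueOn (pointOrbit Γ ω₀)] 0 := by
  set μ := lebesgueOn (pointOrbit Γ ω₀)
  have hint : ∀ l : E n, ∀ w : pointOrbit Γ ω₀ → ℂ, Integrable w μ →
      Integrable (fun θ : pointOrbit Γ ω₀ => modulation l (θ : E n) * w θ) μ := fun l w hw =>
    hw.bdd_mul (character Γ ω₀ l).continuous.aestronglyMeasurable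
      (.of_forall (character Γ ω₀ l).norm_coe_le_norm)
  have hstar : Integrable (fun θ => star (u θ)) μ :=
    Complex.conjCLE.toContinuousLinearMap.integrable_comp hu
  -- Since `𝓛 = -𝓛`, the coefficients of the conjugate of `u` vanish too, hence those of the real
  -- and imaginary parts.
  have h1 : ∀ l ∈ lattice Γ, ∫ θ : pointOrbit Γ ω₀, modulation l (θ : E n) * star (u θ) ∂μ = 0 := by
    intro l hl
    have h2 : ∀ θ : pointOrbit Γ ω₀, modulation l (θ : E n) * star (u θ) =
        starRingEnd ℂ (modulation (-l) (θ : E n) * u θ) := fun θ => by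
      rw [map_mul, starRingEnd_apply, starRingEnd_apply, star_modulation, neg_neg]
    simp only [h2]
    rw [integral_conj, h0 _ (neg_mem hl), map_zero]
  have hre := h.ae_eq_zero_of_integral_modulation_real hu.re fun l hl => by
    have h2 : ∀ θ : pointOrbit Γ ω₀, modulation l (θ : E n) * ((RCLike.re (u θ) : ℝ) : ℂ) =
        (1 / 2 : ℂ) * (modulation l (θ : E n) * u θ + modulation l (θ : E n) * star (u θ)) := by
      intro θ
      have := Complex.re_eq_add_conj (u θ)
      rw [starRingEnd_apply] at this
      rw [RCLike.re_eq_complex_re, this]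
      ring
    simp only [h2]
    rw [integral_const_mul, integral_add (hint l u hu) (hint l _ hstar), h0 l hl, h1 l hl, add_zero,
      mul_zero]
  have him := h.ae_eq_zero_of_integral_modulation_real hu.im fun l hl => by
    have h2 : ∀ θ : pointOrbit Γ ω₀, modulation l (θ : E n) * ((RCLike.im (u θ) : ℝ) : ℂ) =
        (1 / (2 * Complex.I) : ℂ) *
          (modulation l (θ : E n) * u θ - modulation l (θ : E n) * star (u θ)) := by
      intro θ
      have := Complex.im_eq_sub_conj (u θ)
      rw [starRingEnd_apply] at this
      rw [RCLike.im_eq_complex_im, this]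
      ring
    simp only [h2]
    rw [integral_const_mul, integral_sub (hint l u hu) (hint l _ hstar), h0 l hl, h1 l hl, sub_zero,
      mul_zero]
  filter_upwards [hre, him] with θ h2 h3
  exact Complex.ext h2 h3

end IsTiling

end

/-! ### Measurability of closed spans. -/

section

variable {X H : Type*} [MeasurableSpace X] [NormedAddCommGroup H] [InnerProductSpace ℂ H]
  [CompleteSpace H]

/-- Coefficients from a countable dense set suffice for approximation, so a strict bound on the
distance to a closed span is a countable union of conditions on the `v i`. -/
theorem norm_sub_starProjection_closure_span_lt_iff (v : ℕ → H) (ζ : H) (r : ℝ) :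
    ‖ζ - (Submodule.span ℂ (Set.range v)).closure.toSubmodule.starProjection ζ‖ < r ↔
      ∃ (s : Finset ℕ) (j : ℕ),
        ‖ζ - ∑ i ∈ s, TopologicalSpace.denseSeq (ℕ → ℂ) j i • v i‖ < r := by
  set W := (Submodule.span ℂ (Set.range v)).closure
  constructor
  · intro h
    have hmem : W.toSubmodule.starProjection ζ ∈ closure (Submodule.span ℂ (Set.range v) : Set H) :=
      Submodule.starProjection_apply_mem W.toSubmodule ζ
    have hopen : IsOpen {y : H | ‖ζ - y‖ < r} := isOpen_lt (by fun_prop) continuous_const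
    obtain ⟨y, hy, hys⟩ := mem_closure_iff.mp hmem _ hopen h
    obtain ⟨c, rfl⟩ := Finsupp.mem_span_range_iff_exists_finsupp.mp hys
    have hopen' : IsOpen {a : ℕ → ℂ | ‖ζ - ∑ i ∈ c.support, a i • v i‖ < r} :=
      isOpen_lt (by fun_prop) continuous_const
    obtain ⟨j, hj⟩ := (TopologicalSpace.denseRange_denseSeq (ℕ → ℂ)).exists_mem_open hopen' ⟨c, hy⟩
    exact ⟨c.support, j, hj⟩
  · rintro ⟨s, j, h⟩
    refine lt_of_le_of_lt ?_ h
    have hx : ∑ i ∈ s, TopologicalSpace.denseSeq (ℕ → ℂ) j i • v i ∈ W.toSubmodule :=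
      subset_closure (Submodule.sum_mem _ fun i _ =>
        Submodule.smul_mem _ _ (Submodule.subset_span ⟨i, rfl⟩))
    rw [Submodule.starProjection_minimal]
    exact ciInf_le ⟨0, by rintro _ ⟨y, rfl⟩; exact norm_nonneg _⟩ (⟨_, hx⟩ : W.toSubmodule)

/-- The closed span of a sequence of measurable vector fields is a measurable range function. -/
theorem isMeasurableRangeFunction_closure_span {F : ℕ → X → H}
    (hF : ∀ k, StronglyMeasurable (F k)) :
    IsMeasurableRangeFunction fun t =>
      (Submodule.span ℂ (Set.range fun k => F k t)).closure := by
  set J : X → ClosedSubmodule ℂ H := fun t => (Submodule.span ℂ (Set.range fun k => F k t)).closure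
  have hdist : ∀ ζ, Measurable fun t => ‖ζ - (J t).toSubmodule.starProjection ζ‖ := by
    intro ζ
    refine measurable_of_Iio fun r => ?_
    have : (fun t => ‖ζ - (J t).toSubmodule.starProjection ζ‖) ⁻¹' Set.Iio r =
        ⋃ (s : Finset ℕ) (j : ℕ),
          {t | ‖ζ - ∑ i ∈ s, TopologicalSpace.denseSeq (ℕ → ℂ) j i • F i t‖ < r} := by
      ext t
      simp only [Set.mem_preimage, Set.mem_Iio, Set.mem_iUnion]
      exact norm_sub_starProjection_closure_span_lt_iff (fun k => F k t) ζ r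
    rw [this]
    refine MeasurableSet.iUnion fun s => MeasurableSet.iUnion fun j => ?_
    refine measurableSet_lt (StronglyMeasurable.measurable ?_) measurable_const
    exact (stronglyMeasurable_const.sub
      (Finset.stronglyMeasurable_fun_sum _ fun i _ => (hF i).const_smul _)).norm
  -- By Pythagoras the norm of the projection is determined by the distance to the subspace.
  have hnorm : ∀ ζ, Measurable fun t => ‖(J t).toSubmodule.starProjection ζ‖ := by
    intro ζ
    have : (fun t => ‖(J t).toSubmodule.starProjection ζ‖) =
        fun t => √(‖ζ‖ ^ 2 - ‖ζ - (J t).toSubmodule.starProjection ζ‖ ^ 2) := by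
      funext t
      have h := Submodule.norm_sq_eq_add_norm_sq_starProjection ζ (J t).toSubmodule
      rw [Submodule.starProjection_orthogonal'] at h
      rw [h]
      simp
    rw [this]
    exact (((hdist ζ).pow_const 2).const_sub _).sqrt
  intro ξ η
  -- The projection is self-adjoint and idempotent, so polarization reduces its matrix coefficients
  -- to norms of projections.
  have : (fun t => inner ℂ η ((J t).toSubmodule.starProjection ξ)) = fun t =>
      (((‖(J t).toSubmodule.starProjection (η + ξ)‖ : ℂ) ^ 2 -
        (‖(J t).toSubmodule.starProjection (η - ξ)‖ : ℂ) ^ 2 +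
        ((‖(J t).toSubmodule.starProjection (η - Complex.I • ξ)‖ : ℂ) ^ 2 -
          (‖(J t).toSubmodule.starProjection (η + Complex.I • ξ)‖ : ℂ) ^ 2) * Complex.I) / 4) := by
    funext t
    have h : inner ℂ η ((J t).toSubmodule.starProjection ξ) =
        inner ℂ ((J t).toSubmodule.starProjection η) ((J t).toSubmodule.starProjection ξ) := by
      rw [Submodule.inner_starProjection_left_eq_right]
      congr 1
      exact (Submodule.starProjection_eq_self_iff.mpr
        (Submodule.starProjection_apply_mem _ ξ)).symm
    rw [h, inner_eq_sum_norm_sq_div_four]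
    simp only [map_add, map_sub, map_smul]
    rfl
  rw [this]
  have hc : ∀ ζ, Measurable fun t => (‖(J t).toSubmodule.starProjection ζ‖ : ℂ) := fun ζ =>
    Complex.measurable_ofReal.comp (hnorm ζ)
  exact ((((hc _).pow_const 2).sub ((hc _).pow_const 2)).add
    ((((hc _).pow_const 2).sub ((hc _).pow_const 2)).mul_const _)).div_const _

end

/-! ### Covariance of fibres and the range function of an invariant space. -/

section

variable {n : ℕ} {Γ : Subgroup (EucIso n)} {ω₀ : E n}

theorem phase_eq_modulation (y : E n) (ν : dualLattice Γ) : phase y ν = modulation y (ν : E n) := by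
  rw [phase, modulation]
  congr 1
  push_cast
  ring

theorem modulation_map (M : O n) (x z : E n) : modulation (M x) (M z) = modulation x z := by
  rw [modulation, modulation, M.inner_map_map]

theorem modulation_ne_zero (y ω : E n) : modulation y ω ≠ 0 := Complex.exp_ne_zero _

theorem unitaryU_add (a b : E n) (h : ell2 Γ) :
    unitaryU Γ (a + b) h = unitaryU Γ a (unitaryU Γ b h) := by
  refine lp.ext (funext fun ν => ?_)
  rw [unitaryU_apply, unitaryU_apply, unitaryU_apply, phase_eq_modulation, modulation_add_left,
    mul_assoc, ← phase_eq_modulation, ← phase_eq_modulation]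

theorem unitaryU_of_mem_lattice {l : E n} (hl : l ∈ lattice Γ) (h : ell2 Γ) :
    unitaryU Γ l h = h := by
  refine lp.ext (funext fun ν => ?_)
  have : modulation l (ν : E n) = modulation l 0 := by
    rw [modulation_eq_modulation_iff, sub_zero]
    exact ν.2 l hl
  rw [unitaryU_apply, phase_eq_modulation, this]
  simp [modulation]

/-- Hence `U_L` depends only on `L`, not on the representative `x_L`. -/
theorem unitaryU_eq_of_sub_mem {a b : E n} (hab : a - b ∈ lattice Γ) (h : ell2 Γ) :
    unitaryU Γ a h = unitaryU Γ b h := by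
  rw [← sub_add_cancel a b, unitaryU_add, unitaryU_of_mem_lattice hab]

theorem inner_delta (ν : dualLattice Γ) (h : ell2 Γ) : inner ℂ (delta ν) h = h ν := by
  classical
  rw [delta]
  simp [lp.inner_single_left]

theorem mem_mapEquiv_unitaryU {y : E n} {W : ClosedSubmodule ℂ (ell2 Γ)} {v : ell2 Γ} :
    v ∈ W.mapEquiv (unitaryU Γ y).toContinuousLinearEquiv ↔ ∃ w ∈ W, unitaryU Γ y w = v := by
  rw [ClosedSubmodule.mem_mapEquiv_iff]
  constructor
  · exact fun h => ⟨_, h, (unitaryU Γ y).apply_symm_apply v⟩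
  · rintro ⟨w, hw, rfl⟩
    have : (unitaryU Γ y).toContinuousLinearEquiv.symm (unitaryU Γ y w) = w :=
      (unitaryU Γ y).symm_apply_apply w
    rwa [this]

theorem exists_seq_subset_closure (V : ClosedSubmodule ℂ (L2 n)) :
    ∃ q : ℕ → L2 n, (∀ k, q k ∈ V) ∧ ∀ f ∈ V, f ∈ closure (Set.range q) := by
  have : Fact ((2 : ENNReal) ≠ ⊤) := ⟨ENNReal.ofNat_ne_top⟩
  have : SecondCountableTopology (L2 n) := inferInstance
  have hsep := TopologicalSpace.IsSeparable.of_separableSpace (V : Set (L2 n))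
  obtain ⟨c, hcV, hc, hVc⟩ := hsep.exists_countable_dense_subset
  obtain ⟨q, rfl⟩ := hc.exists_eq_range (closure_nonempty_iff.mp ⟨0, hVc V.zero_mem⟩)
  exact ⟨q, fun k => hcV ⟨k, rfl⟩, fun f hf => hVc hf⟩

namespace IsTiling

/-- The isometry `f ↦ F` from `L²(ℝⁿ)` to `L²(ΠΩ, ℓ²(𝓛*))`, where
`f̂ (L (ω + ν)) = ⟨F (Lω), δ_ν⟩`. -/
noncomputable def fourierFiber (h : IsTiling Γ ω₀) :
    L2 n →ₗᵢ[ℂ] Lp (ell2 Γ) 2 (lebesgueOn (pointOrbit Γ ω₀)) :=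
  h.decomp.comp (Lp.fourierTransformₗᵢ (E n) ℂ).symm.toLinearIsometry

theorem ae_fourierFiber (h : IsTiling Γ ω₀) (f : L2 n) :
    ∀ᵐ ω : dirichletDomain Γ ω₀ ∂lebesgueOn (dirichletDomain Γ ω₀),
      ∀ (L : pointGroup Γ) (ν : dualLattice Γ),
        h.fourierFiber f (rot L ω) ν = hat f ((L : O n) ((ω : E n) + (ν : E n))) :=
  h.ae_decomp (hat f)

/-- At `MK(ω + ν)` the phase of the shift is `e^{2πi x·K(ω + ν)}`, which splits into a scalar at
`Kω` and a phase in `ν` with vector `K⁻¹x`. With `K = 1` and `x = x_L` the latter is `U_L`. -/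
theorem ae_fourierFiber_shift (h : IsTiling Γ ω₀) (x : E n) (M : pointGroup Γ) (f : L2 n) :
    ∀ᵐ ω : dirichletDomain Γ ω₀ ∂lebesgueOn (dirichletDomain Γ ω₀), ∀ K : pointGroup Γ,
      h.fourierFiber (shift (isom x M) f) (rot (M * K) ω) =
        modulation x ((K : O n) ω) •
          unitaryU Γ ((K : O n).symm x) (h.fourierFiber f (rot K ω)) := by
  filter_upwards [h.ae_fourierFiber (shift (isom x M) f), h.ae_fourierFiber f,
    h.ae_tile (hat_shift x M f)] with ω h1 h2 h3 K
  refine lp.ext (funext fun ν => ?_)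
  have h4 : ((M * K : pointGroup Γ) : O n) ((ω : E n) + ν) =
      (M : O n) ((K : O n) ((ω : E n) + ν)) := rfl
  have h5 : modulation x ((K : O n) (ν : E n)) = modulation ((K : O n).symm x) (ν : E n) := by
    rw [← modulation_map (K : O n) ((K : O n).symm x), LinearIsometryEquiv.apply_symm_apply]
  rw [h1, h3, lp.coeFn_smul, Pi.smul_apply, unitaryU_apply, h2, h4, modulation_map,
    LinearIsometryEquiv.symm_apply_apply, map_add, modulation_add_right, h5, phase_eq_modulation,
    smul_eq_mul, mul_assoc]

theorem ae_fourierFiber_translate (h : IsTiling Γ ω₀) {l : E n} (hl : l ∈ lattice Γ) (f : L2 n) :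
    ∀ᵐ θ ∂lebesgueOn (pointOrbit Γ ω₀),
      h.fourierFiber (shift (isom l 1) f) θ = modulation l (θ : E n) • h.fourierFiber f θ := by
  rw [h.ae_pointOrbit_iff]
  filter_upwards [h.ae_fourierFiber_shift l 1 f] with ω hω K
  have := hω K
  have h1 : (K : O n).symm l ∈ lattice Γ := map_mem_lattice (inv_mem K.2) hl
  rw [one_mul, unitaryU_of_mem_lattice h1] at this
  exact this

/-- The coordinates force `F` to be `fourierFiber f`, so the existential reduces to a condition on
the fibres of `f`. -/
theorem exists_mem_rangeSpace_iff (h : IsTiling Γ ω₀) (x : pointGroup Γ → E n)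
    (J : dirichletDomain Γ ω₀ → ClosedSubmodule ℂ (ell2 Γ)) (f : L2 n) :
    (∃ F ∈ rangeSpace (lebesgueOn (pointOrbit Γ ω₀)) (twistedExtension x J),
      ∀ᵐ ω : dirichletDomain Γ ω₀ ∂(lebesgueOn (dirichletDomain Γ ω₀)),
        ∀ (L : pointGroup Γ) (ν : dualLattice Γ),
          hat f ((L : O n) ((ω : E n) + (ν : E n))) = inner ℂ (delta ν) (F (rot L ω))) ↔
    ∀ᵐ ω : dirichletDomain Γ ω₀ ∂(lebesgueOn (dirichletDomain Γ ω₀)), ∀ L : pointGroup Γ,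
      ∃ w ∈ J ω, unitaryU Γ (x L) w = h.fourierFiber f (rot L ω) := by
  simp only [inner_delta]
  have key : ∀ F : Lp (ell2 Γ) 2 (lebesgueOn (pointOrbit Γ ω₀)),
      F ∈ rangeSpace (lebesgueOn (pointOrbit Γ ω₀)) (twistedExtension x J) ↔
      ∀ᵐ ω : dirichletDomain Γ ω₀ ∂(lebesgueOn (dirichletDomain Γ ω₀)), ∀ L : pointGroup Γ,
      ∃ w ∈ J ω, unitaryU Γ (x L) w = F (rot L ω) := fun F => by
    change (∀ᵐ θ ∂_, _) ↔ _
    rw [h.ae_pointOrbit_iff]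
    simp only [twistedExtension_rot, mem_mapEquiv_unitaryU]
  constructor
  · rintro ⟨F, hF, hFf⟩
    have : F = h.fourierFiber f := by
      refine Lp.ext (h.ae_eq_of_ae_coeff ?_)
      filter_upwards [hFf, h.ae_fourierFiber f] with ω h1 h2 L ν
      rw [h2, h1]
    exact (key _).mp (this ▸ hF)
  · intro hf
    refine ⟨h.fourierFiber f, (key _).mpr hf, ?_⟩
    filter_upwards [h.ae_fourierFiber f] with ω hω L ν using (hω L ν).symm

/-- The functions with fibres in a twisted extension form a shift-invariant set. -/
theorem fibers_mem_shift (h : IsTiling Γ ω₀) {x : pointGroup Γ → E n}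
    (hx : ∀ L : pointGroup Γ, isom (x L) (L : O n) ∈ Γ)
    {J : dirichletDomain Γ ω₀ → ClosedSubmodule ℂ (ell2 Γ)} {g : EucIso n} (hg : g ∈ Γ) {f : L2 n}
    (hf : ∀ᵐ ω : dirichletDomain Γ ω₀ ∂(lebesgueOn (dirichletDomain Γ ω₀)), ∀ L : pointGroup Γ,
      ∃ w ∈ J ω, unitaryU Γ (x L) w = h.fourierFiber f (rot L ω)) :
    ∀ᵐ ω : dirichletDomain Γ ω₀ ∂(lebesgueOn (dirichletDomain Γ ω₀)), ∀ L : pointGroup Γ,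
      ∃ w ∈ J ω, unitaryU Γ (x L) w = h.fourierFiber (shift g f) (rot L ω) := by
  obtain ⟨y, M, rfl⟩ : ∃ (y : E n) (M : pointGroup Γ), g = isom y (M : O n) :=
    ⟨transPart g, ⟨_, linPart_mem_pointGroup hg⟩, (isom_transPart_linPart g).symm⟩
  filter_upwards [hf, h.ae_fourierFiber_shift y M f] with ω h1 h2 L
  obtain ⟨w, hw, hwf⟩ := h1 (M⁻¹ * L)
  have h3 := h2 (M⁻¹ * L)
  rw [mul_inv_cancel_left] at h3
  refine ⟨modulation y (((M⁻¹ * L : pointGroup Γ) : O n) ω) • w, (J ω).smul_mem _ hw, ?_⟩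
  rw [h3, map_smul, ← hwf, ← unitaryU_add]
  congr 1
  -- The product of `[y, M]` with the representative of `M⁻¹L` lies in `Γ` over `L`, so its
  -- translation part agrees with `x L` modulo `𝓛`.
  refine unitaryU_eq_of_sub_mem (sub_mem_lattice (hx L) ?_) w
  have h4 := mul_mem hg (hx (M⁻¹ * L))
  rw [isom_mul_isom, ← Subgroup.coe_mul, mul_inv_cancel_left, add_comm] at h4
  exact h4

section RangeFunction

variable (h : IsTiling Γ ω₀) (q : ℕ → L2 n)

/-- The closed span of the fibres over `ω ∈ Ω` of a sequence in `L²(ℝⁿ)`. -/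
noncomputable def rangeFunction (ω : dirichletDomain Γ ω₀) : ClosedSubmodule ℂ (ell2 Γ) :=
  (Submodule.span ℂ (Set.range fun k => h.fourierFiber (q k) (rot 1 ω))).closure

theorem isMeasurableRangeFunction_rangeFunction :
    IsMeasurableRangeFunction (h.rangeFunction q) :=
  isMeasurableRangeFunction_closure_span fun _ =>
    (Lp.stronglyMeasurable _).comp_measurable (continuous_rot 1).measurable

variable {q} {V : ClosedSubmodule ℂ (L2 n)}

/-- An `L²`-convergent sequence has a subsequence converging almost everywhere, and `J(ω)` is
closed. -/
theorem fourierFiber_rot_one_mem {f : L2 n} (hf : f ∈ closure (Set.range q)) :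
    ∀ᵐ ω ∂lebesgueOn (dirichletDomain Γ ω₀),
      h.fourierFiber f (rot 1 ω) ∈ h.rangeFunction q ω := by
  obtain ⟨u, hu, hlim⟩ := mem_closure_iff_seq_limit.mp hf
  have h1 : Filter.Tendsto (fun j => h.fourierFiber (u j)) Filter.atTop
      (nhds (h.fourierFiber f)) :=
    (h.fourierFiber.continuous.tendsto f).comp hlim
  obtain ⟨ns, -, hns⟩ := (tendstoInMeasure_of_tendsto_Lp h1).exists_seq_tendsto_ae
  filter_upwards [h.ae_pointOrbit_iff.mp hns] with ω hω
  refine (h.rangeFunction q ω).isClosed.mem_of_tendsto (hω 1) (.of_forall fun j => ?_)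
  obtain ⟨k, hk⟩ := hu (ns j)
  rw [← hk]
  exact subset_closure (Submodule.subset_span ⟨k, rfl⟩)

/-- Writing `f` as the shift by `[x_L, L]` of an element of `V` moves the question from `Lω` to `ω`;
the unimodular scalar is absorbed by the subspace. -/
theorem fibers_mem_rangeFunction (hV : IsShiftInvariant Γ V) {x : pointGroup Γ → E n}
    (hx : ∀ L : pointGroup Γ, isom (x L) (L : O n) ∈ Γ) (hqV : ∀ f ∈ V, f ∈ closure (Set.range q))
    {f : L2 n} (hf : f ∈ V) :
    ∀ᵐ ω : dirichletDomain Γ ω₀ ∂(lebesgueOn (dirichletDomain Γ ω₀)), ∀ L : pointGroup Γ,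
      ∃ w ∈ h.rangeFunction q ω, unitaryU Γ (x L) w = h.fourierFiber f (rot L ω) := by
  have := h.finite_pointGroup
  rw [ae_all_iff]
  intro L
  have hg : shift (isom (x L) L)⁻¹ f ∈ V := hV _ (inv_mem (hx L)) f hf
  have hfg : shift (isom (x L) L) (shift (isom (x L) L)⁻¹ f) = f := by
    ext1
    have hq := (measurePreserving_eucIso (isom (x L) (L : O n))⁻¹).quasiMeasurePreserving.ae_eq_comp
      (coeFn_shift (isom (x L) (L : O n))⁻¹ f)
    filter_upwards [coeFn_shift (isom (x L) (L : O n)) (shift (isom (x L) L)⁻¹ f), hq] with z h1 h2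
    rw [h1, h2, Function.comp_apply, Function.comp_apply, inv_inv, eucIso_apply_inv_apply]
  filter_upwards [h.fourierFiber_rot_one_mem (hqV _ hg),
    h.ae_fourierFiber_shift (x L) L (shift (isom (x L) L)⁻¹ f)] with ω h1 h2
  have h3 := h2 1
  rw [mul_one, hfg] at h3
  refine ⟨_, (h.rangeFunction q ω).smul_mem
    (modulation (x L) (((1 : pointGroup Γ) : O n) ω)) h1, ?_⟩
  rw [h3, map_smul]
  rfl

/-- The inner products of `g` with the lattice translates of `f` are the Fourier coefficients of the
fibrewise inner product; all vanish, so uniqueness applies. -/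
theorem ae_inner_fourierFiber_eq_zero (hV : IsShiftInvariant Γ V) {g f : L2 n}
    (hg : g ∈ V.toSubmoduleᗮ) (hf : f ∈ V) :
    ∀ᵐ θ ∂lebesgueOn (pointOrbit Γ ω₀),
      inner ℂ (h.fourierFiber g θ) (h.fourierFiber f θ) = 0 := by
  refine h.ae_eq_zero_of_integral_modulation (L2.integrable_inner _ _) fun l hl => ?_
  have h1 : shift (isom l 1) f ∈ V := hV _ hl f hf
  have h2 : inner ℂ g (shift (isom l 1) f) = 0 :=
    (Submodule.mem_orthogonal' _ _).mp hg _ h1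
  rw [← h.fourierFiber.inner_map_map, L2.inner_def] at h2
  rw [← h2]
  refine integral_congr_ae ?_
  filter_upwards [h.ae_fourierFiber_translate hl f] with θ hθ
  rw [hθ, inner_smul_right]

theorem mem_of_fibers_mem_rangeFunction (hV : IsShiftInvariant Γ V) {x : pointGroup Γ → E n}
    (hx : ∀ L : pointGroup Γ, isom (x L) (L : O n) ∈ Γ) (hq : ∀ k, q k ∈ V) {f : L2 n}
    (hf : ∀ᵐ ω : dirichletDomain Γ ω₀ ∂(lebesgueOn (dirichletDomain Γ ω₀)), ∀ L : pointGroup Γ,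
      ∃ w ∈ h.rangeFunction q ω, unitaryU Γ (x L) w = h.fourierFiber f (rot L ω)) :
    f ∈ V := by
  have := h.finite_pointGroup
  rw [← ClosedSubmodule.mem_toSubmodule_iff, ← V.toSubmodule.orthogonal_orthogonal,
    Submodule.mem_orthogonal]
  intro g hg
  rw [← h.fourierFiber.inner_map_map, L2.inner_def]
  refine integral_eq_zero_of_ae (h.ae_pointOrbit_iff.mpr ?_)
  -- The shift of `q k` by `[x_L, L]` lies in `V`, and its fibre over `Lω` is a nonzero multiple of
  -- `U_L` applied to the fibre of `q k` over `ω`.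
  have horth : ∀ᵐ ω ∂lebesgueOn (dirichletDomain Γ ω₀), ∀ (L : pointGroup Γ) (k : ℕ),
      inner ℂ (h.fourierFiber g (rot L ω)) (unitaryU Γ (x L)
        (h.fourierFiber (q k) (rot 1 ω))) = 0 := by
    rw [ae_all_iff]
    intro L
    rw [ae_all_iff]
    intro k
    have hk := hV _ (hx L) _ (hq k)
    filter_upwards [h.ae_pointOrbit_iff.mp (h.ae_inner_fourierFiber_eq_zero hV hg hk),
      h.ae_fourierFiber_shift (x L) L (q k)] with ω h1 h2
    have h3 := h1 L
    have h4 := h2 1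
    rw [mul_one] at h4
    rw [h4, inner_smul_right, mul_eq_zero] at h3
    exact h3.resolve_left (modulation_ne_zero _ _)
  filter_upwards [hf, horth] with ω h1 h2 L
  obtain ⟨w, hw, hwf⟩ := h1 L
  change inner ℂ _ _ = 0
  rw [← hwf]
  -- The kernel of `φ` is closed, so orthogonality extends from the generating fibres to their
  -- closed span.
  let φ : ell2 Γ →L[ℂ] ℂ := (innerSL ℂ (h.fourierFiber g (rot L ω))).comp
    ((unitaryU Γ (x L)).toContinuousLinearEquiv : ell2 Γ →L[ℂ] ell2 Γ)
  have hspan : Submodule.span ℂ (Set.range fun k =>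
      h.fourierFiber (q k) (rot 1 ω)) ≤ LinearMap.ker φ.toLinearMap :=
    Submodule.span_le.mpr (by rintro _ ⟨k, rfl⟩; exact h2 L k)
  exact Submodule.topologicalClosure_minimal _ hspan φ.isClosed_ker hw

end RangeFunction

end IsTiling

end

end CrystalShift

open CrystalShift
theorem corollary6p7 {n : ℕ} (hn : 0 < n) (Γ : Subgroup (EucIso n)) (hΓ : IsCrystalGroup Γ)
    (ω₀ : E n) (hω₀ : HasTrivialStabilizer Γ ω₀)
    (x : pointGroup Γ → E n) (hx : ∀ L : pointGroup Γ, isom (x L) (L : O n) ∈ Γ)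
    (V : ClosedSubmodule ℂ (L2 n)) :
    IsShiftInvariant Γ V ↔
      ∃ J : dirichletDomain Γ ω₀ → ClosedSubmodule ℂ (ell2 Γ),
        IsMeasurableRangeFunction J ∧
        ∀ f : L2 n, f ∈ V ↔
          ∃ F ∈ rangeSpace (lebesgueOn (pointOrbit Γ ω₀)) (twistedExtension x J),
            ∀ᵐ ω : dirichletDomain Γ ω₀ ∂(lebesgueOn (dirichletDomain Γ ω₀)),
              ∀ (L : pointGroup Γ) (ν : dualLattice Γ),
                hat f ((L : O n) ((ω : E n) + (ν : E n))) = inner ℂ (delta ν) (F (rot L ω)) := by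
  have h : IsTiling Γ ω₀ := hΓ.isTiling hω₀
  simp only [h.exists_mem_rangeSpace_iff]
  constructor
  · intro hV
    obtain ⟨q, hq, hqV⟩ := exists_seq_subset_closure V
    exact ⟨h.rangeFunction q, h.isMeasurableRangeFunction_rangeFunction q, fun f =>
      ⟨h.fibers_mem_rangeFunction hV hx hqV, h.mem_of_fibers_mem_rangeFunction hV hx hq⟩⟩
  · rintro ⟨J, -, hJ⟩ g hg f hf
    exact (hJ _).mpr (h.fibers_mem_shift hx hg ((hJ f).mp hf))
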